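/- Every $x\in(0,1]$ has Lüroth digits $d_n(x)=\lfloor 1/T^{n-1}(x)\rfloor+1$ $(n\ge 1)$, where $T:(0,1]\to(0,1]$, $T(x)=\lfloor 1/x\rfloor\left(\lfloor 1/x+1\rfloor x-1\right)$. Put $Q_n(x)=d_n(x)\prod_{j=1}^{n-1}d_j(x)(d_j(x)-1)$ and let $\frac{P_n(x)}{Q_n(x)}=\sum_{k=1}^{n}\frac{1}{d_k(x)\prod_{j=1}^{k-1}d_j(x)(d_j(x)-1)}$ be the $n$-th Lüroth convergent of $x$. For a function $\psi$ from the positive integers to $(0,1]$ let $$L(\psi)=\limsup_{n\to\infty}\left\{x\in(0,1]:\left|x-\frac{P_n(x)}{Q_n(x)}\right|<\frac{\psi(Q_n(x))}{Q_n(x)}\right\}$$ be the set of all $x \in (0,1]$ that satisfy the inequality for infinitely many $n$, let $\underline{\tau}_\psi=\liminf_{q\to\infty}\frac{-\log\psi(q)}{\log q}$, let $s=\frac{1}{1+\underline{\tau}_\psi}$ (with $s=0$ if $\underline{\tau}_\psi=\infty$), and let $\theta_s(q)=q^{1-s}\psi(q)^s$ for every integer $q\ge 1$. Theorem. Suppose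 that $\underline{\tau}_\psi>1$, that $\theta_s$ is non-increasing on the positive integers, and that $$\sum_{q=1}^{\infty}\left(\frac{\psi(q)}{q}\right)^s\log q=+\infty.$$ Then the Hausdorff dimension of $L(\psi)$ is $$\dim L(\psi)=\frac{1}{1+\underline{\tau}_\psi}.$$ -/

import Mathlib

open Filter MeasureTheory

namespace Luroth

/-- The Lüroth map `T x = ⌊1/x⌋ (⌊1/x + 1⌋ x - 1)`, meant for `x ∈ (0, 1]`. -/
noncomputable def map (x : ℝ) : ℝ := (⌊1 / x⌋ : ℝ) * ((⌊1 / x + 1⌋ : ℝ) * x - 1)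

/-- The Lüroth digits of `x ∈ (0, 1]`, indexed from `0`: `digit x n` is
`d_{n+1}(x) = ⌊1 / T^n x⌋ + 1`. -/
noncomputable def digit (x : ℝ) (n : ℕ) : ℕ := ⌊1 / (map^[n] x)⌋₊ + 1

/-- The unsimplified denominator `Q_{n+1}(x) = d_{n+1} ∏_{j ≤ n} d_j (d_j - 1)`. All digits are
positive, so the subtraction of natural numbers is a true one. -/
noncomputable def denom (x : ℝ) (n : ℕ) : ℕ :=
  digit x n * ∏ j ∈ Finset.range n, digit x j * (digit x j - 1)

/-- The `(n+1)`-st Lüroth convergent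
`∑_{k=1}^{n+1} 1 / (d_k ∏_{j<k} d_j (d_j - 1))` of `x`. -/
noncomputable def convergent (x : ℝ) (n : ℕ) : ℝ :=
  ∑ k ∈ Finset.range (n + 1),
    1 / ((digit x k : ℝ) * ∏ j ∈ Finset.range k, (digit x j : ℝ) * ((digit x j : ℝ) - 1))

/-- The unsimplified numerator `P_{n+1}(x) = [d_1, …, d_{n+1}] Q_{n+1}(x)`. -/
noncomputable def num (x : ℝ) (n : ℕ) : ℝ := convergent x n * (denom x n : ℝ)

/-- The set `L(ψ)` of Lüroth `ψ`-well approximable numbers. Only the values of `ψ` at positive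
integers matter. -/
noncomputable def wellApproximable (ψ : ℕ → ℝ) : Set ℝ :=
  limsup (fun n : ℕ => {x : ℝ | x ∈ Set.Ioc (0 : ℝ) 1 ∧
    |x - num x n / (denom x n : ℝ)| < ψ (denom x n) / (denom x n : ℝ)}) atTop

/-- The lower order at infinity of `1/ψ`, an extended real number:
`liminf_{q → ∞} (- log ψ(q) / log q)`. -/
noncomputable def lowerOrder (ψ : ℕ → ℝ) : EReal :=
  liminf (fun q : ℕ => ((-Real.log (ψ q) / Real.log q : ℝ) : EReal)) atTop

/-- The exponent `s = 1 / (1 + lowerOrder ψ)` as a real number (`0` if the lower order is `∞`). -/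
noncomputable def exponent (ψ : ℕ → ℝ) : ℝ := (1 / (1 + lowerOrder ψ)).toReal

/-- The auxiliary function `θ_s(q) = q^(1-s) ψ(q)^s`. -/
noncomputable def theta (s : ℝ) (ψ : ℕ → ℝ) (q : ℕ) : ℝ := (q : ℝ) ^ (1 - s) * ψ q ^ s

end Luroth

/-! By `sub_convergent`, `x - P_n/Q_n` is positive and equals `T^n x` divided by the product of the
`d_j (d_j - 1)` with `j ≤ n`; a large digit `d_{n+1}` makes it small.

Upper bound (`dimH_wellApproximable_le`). For `c < 1 + τ`, each point of the limsup set lies in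
`[P_n/Q_n, P_n/Q_n + Q_n^(-c)]` for infinitely many `n`. The sum of `Q^(-ct)` over all words of one
length factorises over the digits. When `ct > 1`, the factor `∑ (d (d - 1))^(-ct)` is below `1`, so
the covers by long words have arbitrarily small `t`-sums.

Lower bound. For `t < s`, a Cantor subset is built in which each digit lies in a window determined
by the digits before it. Rescaling every window to `(0, 1]` codes the points of `(0, 1]` by points
of the subset. `le_dimH_window` shows that the inverse of this coding is `t`-Hölder, whence
dimension at least `t`, as long as a certain mass estimate stays bounded. The default window is `(1,
M]`. After a word with denominator `Q` of even length, the window `(N, 2N]` with `N` just above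
`1/ψ(Q)` is used as soon as the estimate permits it (`Jump`); such a digit gives one good
approximation. The estimate then persists (`mass_mul_vol_mul_le`), and jumps never stop
(`frequently_jump`): without them the digits are bounded, the denominators meet every scale up to a
constant factor, and monotonicity of `θ_s` carries some `q` with `ψ(q) ≥ q^(-(τ+ε))` to a nearby
denominator at which a jump is permitted. -/

namespace Luroth

open scoped ENNReal Topology

/-! ### The Lüroth map, its branches and digits -/

/-- The inverse branch of the Lüroth map on the cylinder of the digit `d`. -/
noncomputable def branch (d : ℕ) (t : ℝ) : ℝ := 1 / d + t / (d * (d - 1))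

/-- The first digit of `x`. -/
noncomputable def head (x : ℝ) : ℕ := ⌊1 / x⌋₊ + 1

lemma digit_eq_head (x : ℝ) (n : ℕ) : digit x n = head (map^[n] x) := rfl

lemma two_le_head {x : ℝ} (hx : x ∈ Set.Ioc (0 : ℝ) 1) : 2 ≤ head x := by
  have : 1 ≤ ⌊1 / x⌋₊ := by
    rw [Nat.one_le_floor_iff]
    rw [le_div_iff₀ hx.1]; linarith [hx.2]
  unfold head; omega

lemma map_eq {x : ℝ} (hx : x ∈ Set.Ioc (0 : ℝ) 1) :
    map x = ((head x : ℝ) - 1) * (head x * x - 1) := by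
  have h : ((⌊1 / x⌋₊ : ℝ)) = (⌊1 / x⌋ : ℝ) :=
    natCast_floor_eq_intCast_floor (by have := hx.1; positivity)
  unfold map head
  rw [Int.floor_add_one]
  push_cast
  rw [h]; ring

lemma head_lt {x : ℝ} (hx : x ∈ Set.Ioc (0 : ℝ) 1) : 1 / (head x : ℝ) < x := by
  have h := Nat.lt_floor_add_one (1 / x)
  have h2 := two_le_head hx
  have h3 : (0 : ℝ) < head x := by positivity
  have h4 : 1 / x < head x := by unfold head; push_cast; exact h
  rw [div_lt_iff₀ hx.1] at h4
  rw [div_lt_iff₀ h3]; linarith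

lemma le_head {x : ℝ} (hx : x ∈ Set.Ioc (0 : ℝ) 1) : x ≤ 1 / ((head x : ℝ) - 1) := by
  have h : (⌊1 / x⌋₊ : ℝ) ≤ 1 / x := Nat.floor_le (by have := hx.1; positivity)
  have h2 : (2 : ℝ) ≤ head x := by exact_mod_cast two_le_head hx
  have h4 : (head x : ℝ) - 1 ≤ 1 / x := by unfold head; push_cast; linarith
  rw [le_div_iff₀ hx.1] at h4
  rw [le_div_iff₀ (by linarith)]; linarith

lemma branch_head_map {x : ℝ} (hx : x ∈ Set.Ioc (0 : ℝ) 1) : branch (head x) (map x) = x := by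
  have h2 : (2 : ℝ) ≤ head x := by exact_mod_cast two_le_head hx
  have h3 : (head x : ℝ) - 1 ≠ 0 := by linarith
  have h4 : (head x : ℝ) ≠ 0 := by linarith
  rw [map_eq hx, branch]
  field_simp
  ring

lemma map_mem {x : ℝ} (hx : x ∈ Set.Ioc (0 : ℝ) 1) : map x ∈ Set.Ioc (0 : ℝ) 1 := by
  have h2 : (2 : ℝ) ≤ head x := by exact_mod_cast two_le_head hx
  have h3 := head_lt hx
  have h4 := le_head hx
  rw [div_lt_iff₀ (by linarith)] at h3
  rw [le_div_iff₀ (by linarith)] at h4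
  rw [map_eq hx]
  constructor
  · apply mul_pos <;> linarith
  · nlinarith

lemma iterate_map_mem {x : ℝ} (hx : x ∈ Set.Ioc (0 : ℝ) 1) (n : ℕ) :
    map^[n] x ∈ Set.Ioc (0 : ℝ) 1 := by
  induction n with
  | zero => exact hx
  | succ n ih => rw [Function.iterate_succ_apply']; exact map_mem ih

lemma two_le_digit {x : ℝ} (hx : x ∈ Set.Ioc (0 : ℝ) 1) (n : ℕ) : 2 ≤ digit x n :=
  two_le_head (iterate_map_mem hx n)

lemma branch_mem {d : ℕ} (hd : 2 ≤ d) {t : ℝ} (ht : t ∈ Set.Ioc (0 : ℝ) 1) :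
    1 / (d : ℝ) < branch d t ∧ branch d t ≤ 1 / ((d : ℝ) - 1) := by
  have h2 : (2 : ℝ) ≤ d := by exact_mod_cast hd
  have h3 : 0 < (d : ℝ) * (d - 1) := mul_pos (by linarith) (by linarith)
  have h5 : (d : ℝ) - 1 ≠ 0 := by linarith
  have h4 : 1 / ((d : ℝ) - 1) = 1 / d + 1 / (d * (d - 1)) := by field_simp; ring
  unfold branch
  constructor
  · have := div_pos ht.1 h3
    linarith
  · rw [h4]
    have : t / ((d : ℝ) * (d - 1)) ≤ 1 / (d * (d - 1)) := by gcongr; exact ht.2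
    linarith

lemma branch_mem_Ioc {d : ℕ} (hd : 2 ≤ d) {t : ℝ} (ht : t ∈ Set.Ioc (0 : ℝ) 1) :
    branch d t ∈ Set.Ioc (0 : ℝ) 1 := by
  have h2 : (2 : ℝ) ≤ d := by exact_mod_cast hd
  have h := branch_mem hd ht
  refine ⟨lt_trans (by positivity) h.1, h.2.trans ?_⟩
  rw [div_le_one (by linarith)]; linarith

lemma head_eq_of_mem {d : ℕ} (hd : 2 ≤ d) {x : ℝ} (h1 : 1 / (d : ℝ) < x)
    (h2 : x ≤ 1 / ((d : ℝ) - 1)) : head x = d := by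
  have hd2 : (2 : ℝ) ≤ d := by exact_mod_cast hd
  have hx : 0 < x := lt_trans (by positivity) h1
  have h : ⌊1 / x⌋₊ = d - 1 := by
    rw [Nat.floor_eq_iff (by positivity)]
    push_cast [Nat.cast_sub (show 1 ≤ d by omega)]
    rw [div_lt_iff₀ (by linarith)] at h1
    rw [le_div_iff₀ (by linarith)] at h2
    constructor
    · rw [le_div_iff₀ hx]; linarith
    · rw [div_lt_iff₀ hx]; linarith
  unfold head; omega

lemma head_branch {d : ℕ} (hd : 2 ≤ d) {t : ℝ} (ht : t ∈ Set.Ioc (0 : ℝ) 1) :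
    head (branch d t) = d :=
  head_eq_of_mem hd (branch_mem hd ht).1 (branch_mem hd ht).2

lemma map_branch {d : ℕ} (hd : 2 ≤ d) {t : ℝ} (ht : t ∈ Set.Ioc (0 : ℝ) 1) :
    map (branch d t) = t := by
  have h2 : (2 : ℝ) ≤ d := by exact_mod_cast hd
  rw [map_eq (branch_mem_Ioc hd ht), head_branch hd ht, branch]
  have h5 : (d : ℝ) - 1 ≠ 0 := by linarith
  have h6 : (d : ℝ) ≠ 0 := by linarith
  field_simp
  ring

/-! ### Cylinder lengths, convergents and points with prescribed digits -/

/-- `∏_{j < n} d_j (d_j - 1)`, the reciprocal of the length of a cylinder. -/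
noncomputable def volProd (a : ℕ → ℕ) (n : ℕ) : ℝ :=
  ∏ j ∈ Finset.range n, (a j : ℝ) * ((a j : ℝ) - 1)

lemma volProd_succ (a : ℕ → ℕ) (n : ℕ) :
    volProd a (n + 1) = volProd a n * ((a n : ℝ) * ((a n : ℝ) - 1)) := by
  simp [volProd, Finset.prod_range_succ]

lemma volProd_succ' (a : ℕ → ℕ) (n : ℕ) :
    volProd a (n + 1) = (a 0 : ℝ) * ((a 0 : ℝ) - 1) * volProd (fun k => a (k + 1)) n := by
  simp [volProd, Finset.prod_range_succ', mul_comm]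

lemma two_le_mul_sub_one {d : ℕ} (hd : 2 ≤ d) : (2 : ℝ) ≤ (d : ℝ) * ((d : ℝ) - 1) := by
  have h2 : (2 : ℝ) ≤ d := by exact_mod_cast hd
  nlinarith

lemma two_pow_le_volProd {a : ℕ → ℕ} (ha : ∀ n, 2 ≤ a n) (n : ℕ) : (2 : ℝ) ^ n ≤ volProd a n := by
  induction n with
  | zero => simp [volProd]
  | succ n ih =>
    rw [volProd_succ, pow_succ]
    exact mul_le_mul ih (two_le_mul_sub_one (ha n)) (by norm_num) (le_trans (by positivity) ih)

lemma volProd_pos {a : ℕ → ℕ} (ha : ∀ n, 2 ≤ a n) (n : ℕ) : 0 < volProd a n :=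
  lt_of_lt_of_le (by positivity) (two_pow_le_volProd ha n)

lemma cast_denom {x : ℝ} (hx : x ∈ Set.Ioc (0 : ℝ) 1) (n : ℕ) :
    (denom x n : ℝ) = digit x n * volProd (digit x) n := by
  unfold denom volProd
  push_cast
  congr 1
  refine Finset.prod_congr rfl fun j _ => ?_
  rw [Nat.cast_sub (by have := two_le_digit hx j; omega)]
  simp

lemma two_pow_le_denom {x : ℝ} (hx : x ∈ Set.Ioc (0 : ℝ) 1) (n : ℕ) :
    (2 : ℝ) ^ (n + 1) ≤ denom x n := by
  rw [cast_denom hx, pow_succ, mul_comm]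
  exact mul_le_mul (by exact_mod_cast two_le_digit hx n)
    (two_pow_le_volProd (two_le_digit hx) n) (by positivity) (by positivity)

lemma denom_pos {x : ℝ} (hx : x ∈ Set.Ioc (0 : ℝ) 1) (n : ℕ) : (0 : ℝ) < denom x n :=
  lt_of_lt_of_le (by positivity) (two_pow_le_denom hx n)

lemma num_div_denom {x : ℝ} (hx : x ∈ Set.Ioc (0 : ℝ) 1) (n : ℕ) :
    num x n / denom x n = convergent x n := by
  rw [num, mul_div_assoc, div_self (denom_pos hx n).ne', mul_one]

/-- Unrolling `x = branch d (T x)` peels off one term of the series at a time. The remainder is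
positive, so convergents approach `x` from below. -/
lemma sub_convergent {x : ℝ} (hx : x ∈ Set.Ioc (0 : ℝ) 1) (n : ℕ) :
    x - convergent x n = map^[n + 1] x / volProd (digit x) (n + 1) := by
  have key : ∀ n, map^[n] x / volProd (digit x) n =
      1 / ((digit x n : ℝ) * volProd (digit x) n) +
        map^[n + 1] x / volProd (digit x) (n + 1) := by
    intro n
    have hy := iterate_map_mem hx n
    have h := branch_head_map hy
    rw [← digit_eq_head, branch, ← Function.iterate_succ_apply' map n x] at h
    have hV := volProd_pos (two_le_digit hx) n
    have h2 : (2 : ℝ) ≤ digit x n := by exact_mod_cast two_le_digit hx n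
    have h5 : (digit x n : ℝ) - 1 ≠ 0 := by linarith
    have h6 : (digit x n : ℝ) ≠ 0 := by linarith
    rw [← h, volProd_succ]
    field_simp
  induction n with
  | zero =>
    have := key 0
    simp only [convergent, volProd, zero_add, Finset.range_one, Finset.sum_singleton,
      Finset.range_zero, Finset.prod_empty, mul_one, Function.iterate_zero, id, div_one] at this ⊢
    linarith
  | succ n ih =>
    have := key (n + 1)
    have hc : convergent x (n + 1) = convergent x n +
        1 / ((digit x (n + 1) : ℝ) * volProd (digit x) (n + 1)) := by
      rw [convergent, Finset.sum_range_succ]; rfl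
    rw [hc]; linarith

/-- The point with a given sequence of digits. -/
noncomputable def point (a : ℕ → ℕ) : ℝ := ∑' k, 1 / ((a k : ℝ) * volProd a k)

lemma point_term_le {a : ℕ → ℕ} (ha : ∀ n, 2 ≤ a n) (k : ℕ) :
    1 / ((a k : ℝ) * volProd a k) ≤ 1 / 2 / 2 ^ k := by
  rw [div_div]
  have h2 : (2 : ℝ) ≤ a k := by exact_mod_cast ha k
  exact one_div_le_one_div_of_le (by positivity)
    (mul_le_mul h2 (two_pow_le_volProd ha k) (by positivity) (by positivity))

lemma point_term_pos {a : ℕ → ℕ} (ha : ∀ n, 2 ≤ a n) (k : ℕ) :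
    0 < 1 / ((a k : ℝ) * volProd a k) := by
  have h2 : (2 : ℝ) ≤ a k := by exact_mod_cast ha k
  have := volProd_pos ha k
  positivity

lemma summable_point {a : ℕ → ℕ} (ha : ∀ n, 2 ≤ a n) :
    Summable fun k => 1 / ((a k : ℝ) * volProd a k) :=
  Summable.of_nonneg_of_le (fun k => (point_term_pos ha k).le) (point_term_le ha)
    (hasSum_geometric_two' 1).summable

lemma point_mem {a : ℕ → ℕ} (ha : ∀ n, 2 ≤ a n) : point a ∈ Set.Ioc (0 : ℝ) 1 := by
  constructor
  · exact (summable_point ha).tsum_pos (fun k => (point_term_pos ha k).le) 0 (point_term_pos ha 0)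
  · have := Summable.tsum_le_tsum (point_term_le ha) (summable_point ha)
      (hasSum_geometric_two' 1).summable
    rwa [(hasSum_geometric_two' (1 : ℝ)).tsum_eq] at this

lemma point_eq_branch {a : ℕ → ℕ} (ha : ∀ n, 2 ≤ a n) :
    point a = branch (a 0) (point fun k => a (k + 1)) := by
  have h2 : (2 : ℝ) ≤ a 0 := by exact_mod_cast ha 0
  unfold point
  rw [(summable_point ha).tsum_eq_zero_add, branch, ← tsum_div_const]
  congr 1
  · simp [volProd]
  · refine tsum_congr fun k => ?_
    rw [volProd_succ', div_div]
    ring_nf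

lemma iterate_map_point {a : ℕ → ℕ} (ha : ∀ n, 2 ≤ a n) (n : ℕ) :
    map^[n] (point a) = point fun k => a (k + n) := by
  induction n with
  | zero => rfl
  | succ n ih =>
    rw [Function.iterate_succ_apply', ih, point_eq_branch (fun k => ha (k + n)),
      map_branch (ha _) (point_mem fun k => ha _)]
    congr 1
    ext k
    congr 1
    omega

/-- Each branch carries `(0, 1]` onto the whole half-open cylinder `(1/d, 1/(d-1)]`, so no sequence
of digits `≥ 2` is excluded. -/
lemma digit_point {a : ℕ → ℕ} (ha : ∀ n, 2 ≤ a n) (n : ℕ) : digit (point a) n = a n := by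
  rw [digit_eq_head, iterate_map_point ha, point_eq_branch (fun k => ha (k + n)),
    head_branch (ha _) (point_mem fun k => ha _), zero_add]

/-- Points with the same first `m` digits. -/
lemma sub_eq_of_digits_eq {x y : ℝ} (hx : x ∈ Set.Ioc (0 : ℝ) 1) (hy : y ∈ Set.Ioc (0 : ℝ) 1)
    (m : ℕ) (h : ∀ j < m, digit x j = digit y j) :
    x - y = (map^[m] x - map^[m] y) / volProd (digit x) m := by
  induction m with
  | zero => simp [volProd]
  | succ n ih =>
    have e := h n (by omega)
    have h1 := branch_head_map (iterate_map_mem hx n)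
    have h2 := branch_head_map (iterate_map_mem hy n)
    rw [← digit_eq_head, branch, ← Function.iterate_succ_apply' map n] at h1 h2
    rw [ih fun j hj => h j (by omega), ← h1, ← h2, e, volProd_succ, e]
    have hd : (2 : ℝ) ≤ digit y n := by exact_mod_cast two_le_digit hy n
    have h5 : (digit y n : ℝ) - 1 ≠ 0 := by linarith
    have h6 : (digit y n : ℝ) ≠ 0 := by linarith
    have := volProd_pos (two_le_digit hx) n
    field_simp
    ring

/-! ### Upper bound: covers by intervals to the right of convergents -/

lemma tsum_fin_pi_prod (F : ℕ → ℝ≥0∞) (n : ℕ) :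
    ∑' v : Fin n → ℕ, ∏ i, F (v i) = (∑' d, F d) ^ n := by
  induction n with
  | zero => simp
  | succ n ih =>
    rw [← (Fin.consEquiv fun _ => ℕ).tsum_eq, ENNReal.tsum_prod', pow_succ, ← ih,
      mul_comm, ← ENNReal.tsum_mul_right]
    refine tsum_congr fun d => ?_
    rw [← ENNReal.tsum_mul_left]
    refine tsum_congr fun v => ?_
    simp [Fin.prod_univ_succ, Fin.consEquiv]

lemma tsum_inv_mul_succ_le_one :
    ∑' d : ℕ, ENNReal.ofReal (1 / (((d : ℝ) + 2) * (d + 1))) ≤ 1 := by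
  refine ENNReal.tsum_le_of_sum_range_le fun n => ?_
  rw [← ENNReal.ofReal_sum_of_nonneg fun d _ => by positivity]
  rw [ENNReal.ofReal_le_one]
  have : ∑ d ∈ Finset.range n, 1 / (((d : ℝ) + 2) * (d + 1)) = 1 - 1 / ((n : ℝ) + 1) := by
    induction n with
    | zero => simp
    | succ n ih =>
      rw [Finset.sum_range_succ, ih]
      push_cast
      field_simp
      ring
  rw [this]
  have : (0 : ℝ) ≤ 1 / ((n : ℝ) + 1) := by positivity
  linarith

/-- Here `d` stands for the digit `d + 2`. The cylinder lengths sum to at most `1`, and since each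
is at most `1/2`, raising them to the power `b` gains the factor `2^(1-b)`. -/
lemma tsum_rpow_lt_one {b : ℝ} (hb : 1 < b) :
    ∑' d : ℕ, ENNReal.ofReal ((((d : ℝ) + 2) * (d + 1)) ^ (-b)) < 1 := by
  have h : ∀ d : ℕ, ENNReal.ofReal ((((d : ℝ) + 2) * (d + 1)) ^ (-b)) ≤
      ENNReal.ofReal (2 ^ (1 - b)) * ENNReal.ofReal (1 / (((d : ℝ) + 2) * (d + 1))) := by
    intro d
    rw [← ENNReal.ofReal_mul (by positivity)]
    refine ENNReal.ofReal_le_ofReal ?_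
    have hp : (2 : ℝ) ≤ ((d : ℝ) + 2) * (d + 1) := by
      have : (0 : ℝ) ≤ d := by positivity
      nlinarith
    have e : (((d : ℝ) + 2) * (d + 1)) ^ (-b) =
        (((d : ℝ) + 2) * (d + 1)) ^ (1 - b) * (1 / (((d : ℝ) + 2) * (d + 1))) := by
      rw [one_div, ← Real.rpow_neg_one, ← Real.rpow_add (by linarith)]
      congr 1; ring
    rw [e]
    refine mul_le_mul_of_nonneg_right ?_ (by positivity)
    exact Real.rpow_le_rpow_of_nonpos (by norm_num) hp (by linarith)
  calc _ ≤ ∑' d : ℕ, ENNReal.ofReal (2 ^ (1 - b)) *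
        ENNReal.ofReal (1 / (((d : ℝ) + 2) * (d + 1))) := ENNReal.tsum_le_tsum h
    _ ≤ ENNReal.ofReal (2 ^ (1 - b)) * 1 := by
      rw [ENNReal.tsum_mul_left]
      gcongr
      exact tsum_inv_mul_succ_le_one
    _ < 1 := by
      rw [mul_one, ENNReal.ofReal_lt_one]
      exact Real.rpow_lt_one_of_one_lt_of_neg (by norm_num) (by linarith)

lemma tsum_nat_rpow_ne_top {b : ℝ} (hb : 1 < b) :
    ∑' d : ℕ, ENNReal.ofReal (((d : ℝ) + 2) ^ (-b)) ≠ ∞ := by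
  have h : Summable fun d : ℕ => ((d : ℝ) + 2) ^ (-b) := by
    have := (summable_nat_add_iff 2).2 (Real.summable_nat_rpow.2 (show -b < -1 by linarith))
    simpa using this
  exact h.tsum_ofReal_ne_top

/-- A digit sequence that starts with the `n + 1` digits encoded by `v` and `e`. -/
def extend {n : ℕ} (v : Fin n → ℕ) (e : ℕ) (j : ℕ) : ℕ :=
  if h : j < n then v ⟨j, h⟩ + 2 else e + 2

lemma extend_self {n : ℕ} (v : Fin n → ℕ) (e : ℕ) : extend v e n = e + 2 := by simp [extend]

lemma volProd_extend {n : ℕ} (v : Fin n → ℕ) (e : ℕ) :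
    volProd (extend v e) n = ∏ i, ((v i : ℝ) + 2) * (v i + 1) := by
  rw [volProd, Finset.prod_range]
  refine Finset.prod_congr rfl fun i _ => ?_
  simp only [extend, i.2, dif_pos]
  push_cast
  ring

/-- The interval used to cover the points whose first digits are encoded by `v` and `e`. -/
noncomputable def coverSet (c : ℝ) {n : ℕ} (v : Fin n → ℕ) (e : ℕ) : Set ℝ :=
  Set.Icc (∑ k ∈ Finset.range (n + 1), 1 / ((extend v e k : ℝ) * volProd (extend v e) k))
    (∑ k ∈ Finset.range (n + 1), 1 / ((extend v e k : ℝ) * volProd (extend v e) k) +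
      (extend v e n * volProd (extend v e) n) ^ (-c))

lemma two_le_extend {n : ℕ} (v : Fin n → ℕ) (e j : ℕ) : 2 ≤ extend v e j := by
  unfold extend; split_ifs <;> omega

lemma ediam_coverSet (c : ℝ) {n : ℕ} (v : Fin n → ℕ) (e : ℕ) :
    Metric.ediam (coverSet c v e) =
      ENNReal.ofReal ((extend v e n * volProd (extend v e) n) ^ (-c)) := by
  rw [coverSet, Real.ediam_Icc]
  congr 1; ring

lemma ediam_coverSet_le {c : ℝ} (hc : 1 ≤ c) {n : ℕ} (v : Fin n → ℕ) (e : ℕ) :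
    Metric.ediam (coverSet c v e) ≤ (1 / 2) ^ n := by
  rw [ediam_coverSet]
  have h1 : (2 : ℝ) ^ n ≤ extend v e n * volProd (extend v e) n := by
    have h2 := two_pow_le_volProd (two_le_extend v e) n
    have h3 : (2 : ℝ) ≤ extend v e n := by exact_mod_cast two_le_extend v e n
    have h4 : (0 : ℝ) < 2 ^ n := by positivity
    nlinarith
  have h5 : (extend v e n * volProd (extend v e) n) ^ (-c) ≤ (1 / 2 : ℝ) ^ n := by
    calc (extend v e n * volProd (extend v e) n) ^ (-c)
        ≤ (extend v e n * volProd (extend v e) n) ^ (-1 : ℝ) :=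
          Real.rpow_le_rpow_of_exponent_le (le_trans (one_le_pow₀ (by norm_num)) h1) (by linarith)
      _ ≤ (1 / 2 : ℝ) ^ n := by
        rw [Real.rpow_neg_one, one_div, inv_pow]
        gcongr
  refine (ENNReal.ofReal_le_ofReal h5).trans ?_
  rw [ENNReal.ofReal_pow (by norm_num), ENNReal.ofReal_div_of_pos (by norm_num)]
  simp

/-- The last digit enters `Q` as `d` and the earlier ones as `d (d - 1)`; this splits the sum over
words into a power of one series times another series. -/
lemma ediam_coverSet_rpow (c t : ℝ) (ht : 0 ≤ t) {n : ℕ} (v : Fin n → ℕ) (e : ℕ) :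
    Metric.ediam (coverSet c v e) ^ t =
      (∏ i, ENNReal.ofReal ((((v i : ℝ) + 2) * (v i + 1)) ^ (-(c * t)))) *
        ENNReal.ofReal (((e : ℝ) + 2) ^ (-(c * t))) := by
  have hQ : (0 : ℝ) ≤ extend v e n * volProd (extend v e) n :=
    mul_nonneg (by positivity) (volProd_pos (two_le_extend v e) n).le
  rw [ediam_coverSet, ENNReal.ofReal_rpow_of_nonneg (by positivity) ht, ← Real.rpow_mul hQ,
    neg_mul, extend_self, volProd_extend, ← ENNReal.ofReal_prod_of_nonneg
      (fun i _ => by positivity), ← ENNReal.ofReal_mul (Finset.prod_nonneg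
        fun i _ => by positivity), Real.mul_rpow (by positivity)
      (Finset.prod_nonneg fun i _ => by positivity), mul_comm,
    Real.finsetProd_rpow _ _ (fun i _ => by positivity)]
  push_cast
  rfl

lemma dimH_wellApproximable_le {ψ : ℕ → ℝ} (t : NNReal) {c : ℝ} (hc : 1 ≤ c)
    (h : ∀ᶠ q : ℕ in atTop, ψ q / q ≤ (q : ℝ) ^ (-c)) (ht : 1 < c * t) :
    dimH (wellApproximable ψ) ≤ t := by
  refine dimH_le_of_hausdorffMeasure_ne_top ?_
  set σ := ∑' d : ℕ, ENNReal.ofReal ((((d : ℝ) + 2) * (d + 1)) ^ (-(c * t))) with hσ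
  set Z := ∑' e : ℕ, ENNReal.ofReal (((e : ℝ) + 2) ^ (-(c * t))) with hZ
  have hσ1 : σ < 1 := tsum_rpow_lt_one ht
  have hZ1 : Z ≠ ∞ := tsum_nat_rpow_ne_top ht
  -- The `N`-th cover uses all words of `N + k + 1` digits, `k ≥ 0`; its `t`-sum is the tail of a
  -- geometric series with ratio `σ`.
  have hsum : ∀ N : ℕ, ∑' i : Σ k : ℕ, (Fin (N + k) → ℕ) × ℕ,
      Metric.ediam (coverSet c i.2.1 i.2.2) ^ (t : ℝ) = σ ^ N * ((1 - σ)⁻¹ * Z) := by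
    intro N
    rw [ENNReal.tsum_sigma']
    have : ∀ k : ℕ, ∑' b : (Fin (N + k) → ℕ) × ℕ,
        Metric.ediam (coverSet c b.1 b.2) ^ (t : ℝ) = σ ^ N * (σ ^ k * Z) := by
      intro k
      rw [ENNReal.tsum_prod']
      simp_rw [ediam_coverSet_rpow c t t.2, ENNReal.tsum_mul_left, ENNReal.tsum_mul_right]
      rw [tsum_fin_pi_prod fun d : ℕ => ENNReal.ofReal ((((d : ℝ) + 2) * (d + 1)) ^ (-(c * t))),
        pow_add, mul_assoc]
    simp_rw [this, ENNReal.tsum_mul_left, ENNReal.tsum_mul_right, ENNReal.tsum_geometric]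
  have hlim : Tendsto (fun N : ℕ => σ ^ N * ((1 - σ)⁻¹ * Z)) atTop (𝓝 0) := by
    have h1 := ENNReal.tendsto_pow_atTop_nhds_zero_of_lt_one hσ1
    have h2 : (1 - σ)⁻¹ * Z ≠ ∞ :=
      ENNReal.mul_ne_top (ENNReal.inv_ne_top.2 (tsub_pos_of_lt hσ1).ne') hZ1
    simpa using ENNReal.Tendsto.mul_const h1 (Or.inr h2)
  have hle := Measure.hausdorffMeasure_le_liminf_tsum (t : ℝ) (wellApproximable ψ)
    (ι := fun N : ℕ => Σ k : ℕ, (Fin (N + k) → ℕ) × ℕ) (l := atTop)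
    (fun N : ℕ => (1 / 2 : ℝ≥0∞) ^ N)
    (ENNReal.tendsto_pow_atTop_nhds_zero_of_lt_one (by simp))
    (fun N i => coverSet c i.2.1 i.2.2)
    (Eventually.of_forall fun N i => (ediam_coverSet_le hc _ _).trans
      (pow_le_pow_of_le_one (by simp) (by simp) (by omega)))
    (by
      obtain ⟨q₀, hq₀⟩ := eventually_atTop.1 h
      filter_upwards [eventually_ge_atTop q₀] with N hN x hx
      rw [wellApproximable, mem_limsup_iff_frequently_mem] at hx
      obtain ⟨n, hn, hx, hxn⟩ := frequently_atTop.1 hx N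
      obtain ⟨k, rfl⟩ := Nat.exists_eq_add_of_le hn
      rw [Set.mem_iUnion]
      set v : Fin (N + k) → ℕ := fun i => digit x i - 2
      set e : ℕ := digit x (N + k) - 2
      have hd : ∀ j ≤ N + k, extend v e j = digit x j := by
        intro j hj
        have := two_le_digit hx j
        rcases hj.lt_or_eq with hj | rfl
        · simp only [extend, hj, dif_pos, v]; omega
        · simp only [extend, lt_irrefl, dif_neg, not_false_eq_true, e]; omega
      have hV : ∀ j ≤ N + k, volProd (extend v e) j = volProd (digit x) j := by
        intro j hj
        refine Finset.prod_congr rfl fun i hi => ?_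
        rw [hd i (by have := Finset.mem_range.1 hi; omega)]
      have hcv : ∑ j ∈ Finset.range (N + k + 1),
          1 / ((extend v e j : ℝ) * volProd (extend v e) j) = convergent x (N + k) := by
        refine Finset.sum_congr rfl fun j hj => ?_
        have := Finset.mem_range.1 hj
        rw [hd j (by omega), hV j (by omega)]; rfl
      refine ⟨⟨k, v, e⟩, ?_⟩
      simp only [coverSet]
      rw [hcv, hd _ le_rfl, hV _ le_rfl, ← cast_denom hx]
      rw [num_div_denom hx, abs_lt] at hxn
      -- Denominators exceed their index, so `N ≥ q₀` puts all of them in the range where the bound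
      -- on `ψ` holds.
      have hq : q₀ ≤ denom x (N + k) := by
        have h1 : (2 : ℝ) ^ (N + k + 1) ≤ denom x (N + k) := two_pow_le_denom hx _
        have h2 : 2 ^ (N + k + 1) ≤ denom x (N + k) := by exact_mod_cast h1
        have h3 : N + k + 1 < 2 ^ (N + k + 1) := Nat.lt_two_pow_self
        omega
      have h3 := hq₀ _ hq
      have h4 := sub_convergent hx (N + k)
      have h5 : 0 ≤ map^[N + k + 1] x / volProd (digit x) (N + k + 1) :=
        div_nonneg (iterate_map_mem hx _).1.le (volProd_pos (two_le_digit hx) _).le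
      constructor <;> linarith [hxn.2])
  simp only [hsum] at hle
  rw [hlim.liminf_eq] at hle
  exact ne_top_of_le_ne_top (by simp) hle

/-! ### Lower bound: dimension of sets with digits in prescribed windows -/

/-- The list of the first `m` terms of a sequence, the newest one first. -/
def hist (a : ℕ → ℕ) : ℕ → List ℕ
  | 0 => []
  | m + 1 => a m :: hist a m

lemma hist_congr {a b : ℕ → ℕ} {m : ℕ} (h : ∀ j < m, a j = b j) : hist a m = hist b m := by
  induction m with
  | zero => rfl
  | succ m ih => rw [hist, hist, h m (by omega), ih fun j hj => h j (by omega)]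

lemma length_hist (a : ℕ → ℕ) (m : ℕ) : (hist a m).length = m := by
  induction m with
  | zero => rfl
  | succ m ih => rw [hist, List.length_cons, ih]

/-- The reciprocal of the length of the cylinder of a word. -/
noncomputable def vol : List ℕ → ℝ
  | [] => 1
  | d :: w => vol w * ((d : ℝ) * ((d : ℝ) - 1))

lemma vol_hist (a : ℕ → ℕ) (m : ℕ) : vol (hist a m) = volProd a m := by
  induction m with
  | zero => simp [hist, vol, volProd]
  | succ m ih => rw [hist, vol, ih, volProd_succ]

/-- Every digit of the word `w` lies in the window `(lo v, hi v]` given by the word `v` of the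
digits before it. -/
def Admissible (lo hi : List ℕ → ℕ) : List ℕ → Prop
  | [] => True
  | d :: w => Admissible lo hi w ∧ lo w < d ∧ d ≤ hi w

/-- The total length of the cylinders of the digits in the window of `w`. -/
noncomputable def gap (lo hi : List ℕ → ℕ) (w : List ℕ) : ℝ := 1 / lo w - 1 / hi w

section Window

variable {lo hi : List ℕ → ℕ}

lemma gap_pos (h1 : ∀ w, 1 ≤ lo w) (h2 : ∀ w, lo w < hi w) (w : List ℕ) : 0 < gap lo hi w := by
  have h3 : (1 : ℝ) ≤ lo w := by exact_mod_cast h1 w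
  have h4 : (lo w : ℝ) < hi w := by exact_mod_cast h2 w
  exact sub_pos.2 (one_div_lt_one_div_of_lt (by linarith) h4)

lemma gap_le_one (h1 : ∀ w, 1 ≤ lo w) (w : List ℕ) : gap lo hi w ≤ 1 := by
  have h3 : (1 : ℝ) ≤ lo w := by exact_mod_cast h1 w
  have h4 : 1 / (lo w : ℝ) ≤ 1 := by rw [div_le_one (by linarith)]; exact h3
  have h5 : 0 ≤ 1 / (hi w : ℝ) := by positivity
  unfold gap; linarith

lemma Admissible.vol_pos (h1 : ∀ w, 1 ≤ lo w) {w : List ℕ} (hw : Admissible lo hi w) :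
    0 < vol w := by
  induction w with
  | nil => simp [vol]
  | cons d w ih =>
    have h2 := two_le_mul_sub_one (show 2 ≤ d by have := h1 w; have := hw.2.1; omega)
    exact mul_pos (ih hw.1) (by linarith)

variable (lo hi) in
/-- The position in `(1 / hi w, 1 / lo w]` that corresponds to `t ∈ (0, 1]`. -/
noncomputable def place (p : List ℕ × ℝ) : ℝ := 1 / hi p.1 + p.2 * gap lo hi p.1

variable (lo hi) in
/-- One step of the expansion of a number relative to the windows. -/
noncomputable def runStep (p : List ℕ × ℝ) : List ℕ × ℝ :=
  (head (place lo hi p) :: p.1, map (place lo hi p))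

variable (lo hi) in
/-- The word and the remainder after `m` steps of the expansion of `y`. -/
noncomputable def run (y : ℝ) (m : ℕ) : List ℕ × ℝ := (runStep lo hi)^[m] ([], y)

variable (lo hi) in
/-- The digits of the expansion of `y` relative to the windows. -/
noncomputable def out (y : ℝ) (m : ℕ) : ℕ := head (place lo hi (run lo hi y m))

lemma run_succ (y : ℝ) (m : ℕ) : run lo hi y (m + 1) = runStep lo hi (run lo hi y m) := by
  rw [run, Function.iterate_succ_apply']; rfl

lemma run_fst (y : ℝ) (m : ℕ) : (run lo hi y m).1 = hist (out lo hi y) m := by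
  induction m with
  | zero => rfl
  | succ m ih => rw [run_succ, hist, ← ih]; rfl

lemma place_mem (h1 : ∀ w, 1 ≤ lo w) (h2 : ∀ w, lo w < hi w) {p : List ℕ × ℝ}
    (hp : p.2 ∈ Set.Ioc (0 : ℝ) 1) :
    1 / (hi p.1 : ℝ) < place lo hi p ∧ place lo hi p ≤ 1 / (lo p.1 : ℝ) := by
  have hg := gap_pos h1 h2 p.1
  have := mul_pos hp.1 hg
  have : p.2 * gap lo hi p.1 ≤ 1 * gap lo hi p.1 := mul_le_mul_of_nonneg_right hp.2 hg.le
  have e : 1 / (lo p.1 : ℝ) = 1 / hi p.1 + 1 * gap lo hi p.1 := by unfold gap; ring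
  unfold place
  constructor
  · linarith
  · rw [e]; linarith

lemma place_mem_Ioc (h1 : ∀ w, 1 ≤ lo w) (h2 : ∀ w, lo w < hi w) {p : List ℕ × ℝ}
    (hp : p.2 ∈ Set.Ioc (0 : ℝ) 1) : place lo hi p ∈ Set.Ioc (0 : ℝ) 1 := by
  have h := place_mem h1 h2 hp
  have h3 : (1 : ℝ) ≤ lo p.1 := by exact_mod_cast h1 p.1
  refine ⟨lt_of_le_of_lt (by positivity) h.1, h.2.trans ?_⟩
  rw [div_le_one (by linarith)]; exact h3

lemma run_snd_mem (h1 : ∀ w, 1 ≤ lo w) (h2 : ∀ w, lo w < hi w) {y : ℝ}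
    (hy : y ∈ Set.Ioc (0 : ℝ) 1) (m : ℕ) : (run lo hi y m).2 ∈ Set.Ioc (0 : ℝ) 1 := by
  induction m with
  | zero => exact hy
  | succ m ih => rw [run_succ]; exact map_mem (place_mem_Ioc h1 h2 ih)

lemma lo_lt_out (h1 : ∀ w, 1 ≤ lo w) (h2 : ∀ w, lo w < hi w) {y : ℝ}
    (hy : y ∈ Set.Ioc (0 : ℝ) 1) (m : ℕ) : lo (hist (out lo hi y) m) < out lo hi y m := by
  have hp := run_snd_mem h1 h2 hy m
  have h := (head_lt (place_mem_Ioc h1 h2 hp)).trans_le (place_mem h1 h2 hp).2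
  rw [← run_fst]
  have h4 : (2 : ℝ) ≤ head (place lo hi (run lo hi y m)) := by
    exact_mod_cast two_le_head (place_mem_Ioc h1 h2 hp)
  have := lt_of_one_div_lt_one_div (by linarith) h
  exact_mod_cast this

lemma out_le_hi (h1 : ∀ w, 1 ≤ lo w) (h2 : ∀ w, lo w < hi w) {y : ℝ}
    (hy : y ∈ Set.Ioc (0 : ℝ) 1) (m : ℕ) : out lo hi y m ≤ hi (hist (out lo hi y) m) := by
  have hp := run_snd_mem h1 h2 hy m
  have h := (place_mem h1 h2 hp).1.trans_le (le_head (place_mem_Ioc h1 h2 hp))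
  have h4 : (2 : ℝ) ≤ head (place lo hi (run lo hi y m)) := by
    exact_mod_cast two_le_head (place_mem_Ioc h1 h2 hp)
  rw [← run_fst]
  have h6 : (0 : ℝ) < hi (run lo hi y m).1 := by
    exact_mod_cast (h1 _).trans (h2 _).le
  have := lt_of_one_div_lt_one_div h6 h
  have h5 : (out lo hi y m : ℝ) < (hi (run lo hi y m).1 + 1 : ℕ) := by
    push_cast; unfold out; linarith
  have : out lo hi y m < hi (run lo hi y m).1 + 1 := by exact_mod_cast h5
  omega

lemma two_le_out (h1 : ∀ w, 1 ≤ lo w) (h2 : ∀ w, lo w < hi w) {y : ℝ}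
    (hy : y ∈ Set.Ioc (0 : ℝ) 1) (m : ℕ) : 2 ≤ out lo hi y m := by
  have := lo_lt_out h1 h2 hy m
  have := h1 (hist (out lo hi y) m)
  omega

lemma admissible_hist {a : ℕ → ℕ} (h : ∀ m, lo (hist a m) < a m ∧ a m ≤ hi (hist a m)) (m : ℕ) :
    Admissible lo hi (hist a m) := by
  induction m with
  | zero => trivial
  | succ m ih => exact ⟨ih, h m⟩

lemma admissible_hist_out (h1 : ∀ w, 1 ≤ lo w) (h2 : ∀ w, lo w < hi w) {y : ℝ}
    (hy : y ∈ Set.Ioc (0 : ℝ) 1) (m : ℕ) : Admissible lo hi (hist (out lo hi y) m) :=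
  admissible_hist (fun m => ⟨lo_lt_out h1 h2 hy m, out_le_hi h1 h2 hy m⟩) m

variable {P : List ℕ → ℝ}

lemma mass_pos (h1 : ∀ w, 1 ≤ lo w) (h2 : ∀ w, lo w < hi w) (hP0 : P [] = 1)
    (hP : ∀ d w, P (d :: w) = P w / gap lo hi w) (w : List ℕ) : 0 < P w := by
  induction w with
  | nil => rw [hP0]; norm_num
  | cons d w ih => rw [hP]; exact div_pos ih (gap_pos h1 h2 w)

/-- A step contracts the remainder by the gap and then stretches it by `d (d - 1)`. Hence `P w / vol
w` is the length of the interval of `y` whose expansion starts with `w`. -/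
lemma sub_eq_of_out_eq (h1 : ∀ w, 1 ≤ lo w) (h2 : ∀ w, lo w < hi w) (hP0 : P [] = 1)
    (hP : ∀ d w, P (d :: w) = P w / gap lo hi w) {y y' : ℝ}
    (hy : y ∈ Set.Ioc (0 : ℝ) 1) (hy' : y' ∈ Set.Ioc (0 : ℝ) 1) (m : ℕ)
    (h : ∀ j < m, out lo hi y j = out lo hi y' j) :
    y - y' = ((run lo hi y m).2 - (run lo hi y' m).2) *
      (P (hist (out lo hi y) m) / vol (hist (out lo hi y) m)) := by
  induction m with
  | zero => simp [run, hist, vol, hP0]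
  | succ m ih =>
    rw [ih fun j hj => h j (by omega), run_succ, run_succ, hist, hP, vol]
    have hm := h m (by omega)
    have hh : (run lo hi y' m).1 = (run lo hi y m).1 := by
      rw [run_fst, run_fst]; exact hist_congr fun j hj => (h j (by omega)).symm
    have hd : (2 : ℝ) ≤ out lo hi y m := by exact_mod_cast two_le_out h1 h2 hy m
    have hd1 : (out lo hi y m : ℝ) - 1 ≠ 0 := by linarith
    have hd2 : (out lo hi y m : ℝ) ≠ 0 := by linarith
    have hg := gap_pos h1 h2 (hist (out lo hi y) m)
    have hV := (admissible_hist_out h1 h2 hy m).vol_pos h1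
    have b1 := branch_head_map (place_mem_Ioc h1 h2 (run_snd_mem h1 h2 hy m))
    have b2 := branch_head_map (place_mem_Ioc h1 h2 (run_snd_mem h1 h2 hy' m))
    have key : (map (place lo hi (run lo hi y m)) - map (place lo hi (run lo hi y' m))) =
        (out lo hi y m : ℝ) * (out lo hi y m - 1) *
        (((run lo hi y m).2 - (run lo hi y' m).2) * gap lo hi (hist (out lo hi y) m)) := by
      have : ((run lo hi y m).2 - (run lo hi y' m).2) * gap lo hi (hist (out lo hi y) m) =
          place lo hi (run lo hi y m) - place lo hi (run lo hi y' m) := by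
        unfold place
        rw [hh, run_fst]
        ring
      change branch (out lo hi y m) _ = _ at b1
      change branch (out lo hi y' m) _ = _ at b2
      rw [← hm] at b2
      rw [this]
      conv_rhs => rw [← b1, ← b2]
      unfold branch
      field_simp
      ring
    unfold runStep
    simp only
    rw [key]
    field_simp

/-- The Hölder estimate at the first digit where the two expansions differ. Common digits scale `y -
y'` by `P w / vol w` and `x - x'` by `1 / vol w`, so it remains to compare the positions `z`, `z'`
of the driving expansion with `T^m x`, `T^m x'`. The remainder difference `X` is at most `1`, so `X
≤ X^t`, and `hC` collects all the factors. -/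
lemma sub_le_of_out_lt (h1 : ∀ w, 1 ≤ lo w) (h2 : ∀ w, lo w < hi w) (hP0 : P [] = 1)
    (hP : ∀ d w, P (d :: w) = P w / gap lo hi w) {t C : ℝ} (ht : 0 < t) (ht1 : t ≤ 1)
    (hC : ∀ d w, Admissible lo hi (d :: w) →
      P w * vol w ^ (t - 1) * (hi (d :: w) / gap lo hi w) ^ t ≤ C) {y y' : ℝ}
    (hy : y ∈ Set.Ioc (0 : ℝ) 1) (hy' : y' ∈ Set.Ioc (0 : ℝ) 1) (m : ℕ)
    (h : ∀ j < m, out lo hi y j = out lo hi y' j) (hm : out lo hi y m < out lo hi y' m) :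
    |y - y'| ≤ 2 * C * |point (out lo hi y) - point (out lo hi y')| ^ t := by
  set a := out lo hi y with ha
  set a' := out lo hi y' with ha'
  have ha2 : ∀ n, 2 ≤ a n := two_le_out h1 h2 hy
  have ha2' : ∀ n, 2 ≤ a' n := two_le_out h1 h2 hy'
  set w := hist a m with hw
  set z := place lo hi (run lo hi y m) with hz
  set z' := place lo hi (run lo hi y' m) with hz'
  set x := point a with hx
  set x' := point a' with hx'
  have hV : 0 < vol w := (admissible_hist_out h1 h2 hy m).vol_pos h1
  have hg : 0 < gap lo hi w := gap_pos h1 h2 w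
  have hPw : 0 < P w := mass_pos h1 h2 hP0 hP w
  have hxm := point_mem ha2
  have hxm' := point_mem ha2'
  have hux : x - x' = (map^[m] x - map^[m] x') / vol w := by
    rw [sub_eq_of_digits_eq hxm hxm' m fun j hj => by
      rw [digit_point ha2, digit_point ha2', h j hj], hw, vol_hist]
    congr 2
    ext n; exact digit_point ha2 n
  have hd : (2 : ℝ) ≤ a m := by exact_mod_cast ha2 m
  have hdd : (a m : ℝ) + 1 ≤ a' m := by exact_mod_cast hm
  have hn : (2 : ℝ) ≤ a (m + 1) := by exact_mod_cast ha2 (m + 1)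
  have hzI := place_mem_Ioc h1 h2 (run_snd_mem h1 h2 hy m)
  have hzI' := place_mem_Ioc h1 h2 (run_snd_mem h1 h2 hy' m)
  have z1 : 1 / (a m : ℝ) < z := head_lt hzI
  have z2 : z ≤ 1 / ((a m : ℝ) - 1) := le_head hzI
  have z1' : 1 / (a' m : ℝ) < z' := head_lt hzI'
  have z2' : z' ≤ 1 / ((a' m : ℝ) - 1) := le_head hzI'
  have hu : map^[m] x = 1 / (a m : ℝ) + map^[m + 1] x / ((a m : ℝ) * ((a m : ℝ) - 1)) := by
    have := branch_head_map (iterate_map_mem hxm m)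
    rw [← digit_eq_head, digit_point ha2, ← Function.iterate_succ_apply' map m] at this
    exact this.symm
  have hv : 1 / (a (m + 1) : ℝ) < map^[m + 1] x := by
    have := head_lt (iterate_map_mem hxm (m + 1))
    rwa [← digit_eq_head, digit_point ha2] at this
  have hu' : map^[m] x' ≤ 1 / ((a' m : ℝ) - 1) := by
    have := le_head (iterate_map_mem hxm' m)
    rwa [← digit_eq_head, digit_point ha2'] at this
  have g0 : 1 / ((a' m : ℝ) - 1) ≤ 1 / (a m : ℝ) :=
    one_div_le_one_div_of_le (by linarith) (by linarith)
  have hh0 : 0 < 1 / ((a m : ℝ) * ((a m : ℝ) - 1)) :=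
    one_div_pos.2 (mul_pos (by linarith) (by linarith))
  have e1 : 1 / ((a m : ℝ) - 1) = 1 / (a m : ℝ) + 1 / ((a m : ℝ) * ((a m : ℝ) - 1)) := by
    have : (a m : ℝ) - 1 ≠ 0 := by linarith
    field_simp; ring
  have e2 : 1 / ((a' m : ℝ) - 1) = 1 / (a' m : ℝ) + 1 / ((a' m : ℝ) * ((a' m : ℝ) - 1)) := by
    have : (a' m : ℝ) - 1 ≠ 0 := by linarith
    have : (a' m : ℝ) ≠ 0 := by linarith
    field_simp; ring
  have hh : 1 / ((a' m : ℝ) * ((a' m : ℝ) - 1)) ≤ 1 / ((a m : ℝ) * ((a m : ℝ) - 1)) :=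
    one_div_le_one_div_of_le (mul_pos (by linarith) (by linarith)) (by nlinarith)
  have hvu : 1 / (a (m + 1) : ℝ) * (1 / ((a m : ℝ) * ((a m : ℝ) - 1))) ≤
      map^[m + 1] x / ((a m : ℝ) * ((a m : ℝ) - 1)) := by
    rw [div_eq_mul_one_div (map^[m + 1] x)]
    exact mul_le_mul_of_nonneg_right hv.le hh0.le
  -- The difference `z - z'` is at most the distance between the two cylinders plus both their
  -- lengths, each at most `h = 1 / (a m * (a m - 1))`. The point `T^m x` stays `h / a (m + 1)` away
  -- from the left end of its cylinder, because its next digit is `a (m + 1)`; the factor `2 * a (m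
  -- + 1)` makes up for the two lengths.
  have hzu : z - z' ≤ 2 * a (m + 1) * (map^[m] x - map^[m] x') := by
    have s1 : 1 / (a m : ℝ) - 1 / ((a' m : ℝ) - 1) +
        1 / (a (m + 1) : ℝ) * (1 / ((a m : ℝ) * ((a m : ℝ) - 1))) ≤ map^[m] x - map^[m] x' := by
      linarith
    have s2 := mul_le_mul_of_nonneg_left s1 (show (0 : ℝ) ≤ 2 * a (m + 1) by positivity)
    have s3 : 2 * (a (m + 1) : ℝ) * (1 / (a m : ℝ) - 1 / ((a' m : ℝ) - 1) +
        1 / (a (m + 1) : ℝ) * (1 / ((a m : ℝ) * ((a m : ℝ) - 1)))) =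
        2 * (a (m + 1) : ℝ) * (1 / (a m : ℝ) - 1 / ((a' m : ℝ) - 1)) +
          2 * (1 / ((a m : ℝ) * ((a m : ℝ) - 1))) := by
      rw [mul_add]
      congr 1
      field_simp
    have s4 : 1 * (1 / (a m : ℝ) - 1 / ((a' m : ℝ) - 1)) ≤
        2 * (a (m + 1) : ℝ) * (1 / (a m : ℝ) - 1 / ((a' m : ℝ) - 1)) :=
      mul_le_mul_of_nonneg_right (by linarith) (by linarith)
    linarith
  have hzz : 0 < z - z' := by linarith
  have hww : (run lo hi y' m).1 = w := by
    rw [run_fst]; exact hist_congr fun j hj => (h j hj).symm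
  have hX : z - z' = ((run lo hi y m).2 - (run lo hi y' m).2) * gap lo hi w := by
    rw [hz, hz', place, place, hww, run_fst]; ring
  set X := (run lo hi y m).2 - (run lo hi y' m).2 with hXdef
  have hX0 : 0 < X := by
    rw [hX] at hzz
    exact pos_of_mul_pos_left hzz hg.le
  have hX1 : X ≤ 1 := by
    have := (run_snd_mem h1 h2 hy m).2
    have := (run_snd_mem h1 h2 hy' m).1
    linarith
  have hxx : 0 < x - x' := by
    rw [hux]; refine div_pos ?_ hV
    have : 0 < 1 / (a (m + 1) : ℝ) * (1 / ((a m : ℝ) * ((a m : ℝ) - 1))) :=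
      mul_pos (by positivity) hh0
    linarith
  have hXY : X ≤ 2 * (hi (a m :: w) / gap lo hi w) * vol w * (x - x') := by
    have hnx : (a (m + 1) : ℝ) ≤ hi (a m :: w) := by exact_mod_cast out_le_hi h1 h2 hy (m + 1)
    have e : X = (z - z') / gap lo hi w := by rw [hX]; field_simp
    have e' : map^[m] x - map^[m] x' = vol w * (x - x') := by rw [hux]; field_simp
    rw [e, div_le_iff₀ hg]
    calc z - z' ≤ 2 * a (m + 1) * (vol w * (x - x')) := by rw [← e']; exact hzu
      _ ≤ 2 * hi (a m :: w) * (vol w * (x - x')) := by gcongr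
      _ = _ := by field_simp
  have hyy : y - y' = X * (P w / vol w) := sub_eq_of_out_eq h1 h2 hP0 hP hy hy' m h
  have hy0 : 0 < y - y' := by rw [hyy]; positivity
  rw [abs_of_pos hy0, abs_of_pos hxx, hyy]
  have hhi : (0 : ℝ) ≤ hi (a m :: w) / gap lo hi w := by positivity
  have hCw := hC (a m) w (admissible_hist_out h1 h2 hy (m + 1))
  have hC0 : 0 ≤ C := le_trans (by positivity) hCw
  calc X * (P w / vol w) ≤ (2 * (hi (a m :: w) / gap lo hi w) * vol w * (x - x')) ^ t *
        (P w / vol w) := by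
        gcongr
        calc X = X ^ (1 : ℝ) := (Real.rpow_one X).symm
          _ ≤ X ^ t := Real.rpow_le_rpow_of_exponent_ge hX0 hX1 ht1
          _ ≤ _ := Real.rpow_le_rpow hX0.le hXY ht.le
    _ = 2 ^ t * (P w * vol w ^ (t - 1) * (hi (a m :: w) / gap lo hi w) ^ t) * (x - x') ^ t := by
        rw [Real.mul_rpow (by positivity) hxx.le, Real.mul_rpow (by positivity) hV.le,
          Real.mul_rpow (by norm_num) hhi, Real.rpow_sub_one hV.ne']
        ring
    _ ≤ 2 * C * (x - x') ^ t := by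
        have : (2 : ℝ) ^ t ≤ 2 := by
          calc (2 : ℝ) ^ t ≤ 2 ^ (1 : ℝ) := Real.rpow_le_rpow_of_exponent_le (by norm_num) ht1
            _ = 2 := Real.rpow_one 2
        gcongr

/-- Since `hi / gap ≥ 1`, the bound `hC` gives `P w / vol w ≤ C * vol w ^ (-t)`, which tends to `0`
because `vol w ≥ 2 ^ m`. -/
lemma eq_of_out_eq (h1 : ∀ w, 1 ≤ lo w) (h2 : ∀ w, lo w < hi w) (hP0 : P [] = 1)
    (hP : ∀ d w, P (d :: w) = P w / gap lo hi w) {t C : ℝ} (ht : 0 < t)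
    (hC : ∀ d w, Admissible lo hi (d :: w) →
      P w * vol w ^ (t - 1) * (hi (d :: w) / gap lo hi w) ^ t ≤ C) {y y' : ℝ}
    (hy : y ∈ Set.Ioc (0 : ℝ) 1) (hy' : y' ∈ Set.Ioc (0 : ℝ) 1)
    (h : ∀ j, out lo hi y j = out lo hi y' j) : y = y' := by
  have hb : ∀ m : ℕ, |y - y'| ≤ C * (2 ^ (-t) : ℝ) ^ m := by
    intro m
    set w := hist (out lo hi y) m
    have hV : 0 < vol w := (admissible_hist_out h1 h2 hy m).vol_pos h1
    have hg : 0 < gap lo hi w := gap_pos h1 h2 w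
    have hg1 : gap lo hi w ≤ 1 := gap_le_one h1 w
    have hPw : 0 < P w := mass_pos h1 h2 hP0 hP w
    have hCw := hC (out lo hi y m) w (admissible_hist_out h1 h2 hy (m + 1))
    have hX : |(run lo hi y m).2 - (run lo hi y' m).2| ≤ 1 := by
      have a1 := run_snd_mem h1 h2 hy m
      have a2 := run_snd_mem h1 h2 hy' m
      rw [abs_le]
      constructor <;> linarith [a1.1, a1.2, a2.1, a2.2]
    have h2m : (2 : ℝ) ^ m ≤ vol w := by
      rw [vol_hist]; exact two_pow_le_volProd (two_le_out h1 h2 hy) m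
    have hhi : (1 : ℝ) ≤ hi (out lo hi y m :: w) / gap lo hi w := by
      rw [le_div_iff₀ hg]
      have : (1 : ℝ) ≤ hi (out lo hi y m :: w) := by
        exact_mod_cast (h1 _).trans (h2 _).le
      linarith
    have hPV : P w * vol w ^ (t - 1) ≤ C :=
      (le_mul_of_one_le_right (by positivity) (Real.one_le_rpow hhi ht.le)).trans hCw
    have hC0 : 0 ≤ C := le_trans (by positivity) hPV
    rw [sub_eq_of_out_eq h1 h2 hP0 hP hy hy' m fun j _ => h j, abs_mul,
      abs_of_pos (div_pos hPw hV)]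
    calc _ ≤ 1 * (P w / vol w) := by gcongr
      _ = (P w * vol w ^ (t - 1)) * vol w ^ (-t) := by
        rw [mul_assoc, ← Real.rpow_add hV, one_mul, show t - 1 + -t = -1 by ring,
          Real.rpow_neg_one, div_eq_mul_inv]
      _ ≤ C * (2 ^ m : ℝ) ^ (-t) := by
        exact mul_le_mul hPV
          (Real.rpow_le_rpow_of_nonpos (by positivity) h2m (neg_nonpos.2 ht.le)) (by positivity) hC0
      _ = _ := by
        rw [← Real.rpow_natCast, ← Real.rpow_natCast, ← Real.rpow_mul (by norm_num),
          ← Real.rpow_mul (by norm_num), mul_comm (m : ℝ)]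
  have hlim : Tendsto (fun m : ℕ => C * (2 ^ (-t) : ℝ) ^ m) atTop (𝓝 (C * 0)) :=
    (tendsto_pow_atTop_nhds_zero_of_lt_one (by positivity)
      (Real.rpow_lt_one_of_one_lt_of_neg (by norm_num) (neg_lt_zero.2 ht))).const_mul C
  have := ge_of_tendsto' hlim hb
  rw [mul_zero] at this
  exact sub_eq_zero.1 (abs_eq_zero.1 (le_antisymm this (abs_nonneg _)))

/-- A lower bound for the Hausdorff dimension of the set of numbers each of whose digits lies in a
window that depends on the digits before it. -/
theorem le_dimH_window (h1 : ∀ w, 1 ≤ lo w) (h2 : ∀ w, lo w < hi w) (hP0 : P [] = 1)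
    (hP : ∀ d w, P (d :: w) = P w / gap lo hi w) {t : NNReal} {C : ℝ} (ht : 0 < t) (ht1 : t ≤ 1)
    (hC : ∀ d w, Admissible lo hi (d :: w) →
      P w * vol w ^ ((t : ℝ) - 1) * (hi (d :: w) / gap lo hi w) ^ (t : ℝ) ≤ C) :
    (t : ℝ≥0∞) ≤ dimH {x : ℝ | x ∈ Set.Ioc (0 : ℝ) 1 ∧
      ∀ m, lo (hist (digit x) m) < digit x m ∧ digit x m ≤ hi (hist (digit x) m)} := by
  set E := {x : ℝ | x ∈ Set.Ioc (0 : ℝ) 1 ∧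
      ∀ m, lo (hist (digit x) m) < digit x m ∧ digit x m ≤ hi (hist (digit x) m)} with hE
  set g : ℝ → ℝ := fun y => point (out lo hi y) with hg
  set I := Set.Ioc (0 : ℝ) 1 with hI
  have ht' : (0 : ℝ) < t := by exact_mod_cast ht
  have hgE : g '' I ⊆ E := by
    rintro _ ⟨y, hy, rfl⟩
    have e : digit (g y) = out lo hi y := funext fun n => digit_point (two_le_out h1 h2 hy) n
    refine ⟨point_mem (two_le_out h1 h2 hy), fun m => ?_⟩
    rw [e]
    exact ⟨lo_lt_out h1 h2 hy m, out_le_hi h1 h2 hy m⟩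
  have hol : ∀ y ∈ I, ∀ y' ∈ I, |y - y'| ≤ 2 * C * |g y - g y'| ^ (t : ℝ) := by
    intro y hy y' hy'
    by_cases h : ∀ j, out lo hi y j = out lo hi y' j
    · rw [eq_of_out_eq h1 h2 hP0 hP ht' hC hy hy' h]
      simp [ht'.ne']
    · push Not at h
      classical
      have hlt : ∀ j < Nat.find h, out lo hi y j = out lo hi y' j := fun j hj => by
        simpa using Nat.find_min h hj
      rcases lt_or_gt_of_ne (Nat.find_spec h) with hl | hl
      · exact sub_le_of_out_lt h1 h2 hP0 hP ht' (by exact_mod_cast ht1) hC hy hy' _ hlt hl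
      · rw [abs_sub_comm, abs_sub_comm (g y)]
        exact sub_le_of_out_lt h1 h2 hP0 hP ht' (by exact_mod_cast ht1) hC hy' hy _
          (fun j hj => (hlt j hj).symm) hl
  have hinj : Set.InjOn g I := by
    intro y hy y' hy' hyy
    have := hol y hy y' hy'
    rw [hyy, sub_self, abs_zero, Real.zero_rpow ht'.ne', mul_zero] at this
    exact sub_eq_zero.1 (abs_eq_zero.1 (le_antisymm this (abs_nonneg _)))
  -- The coding `g` need not be continuous. Only its inverse matters: a `t`-Hölder map from `g '' I`
  -- onto the one-dimensional set `I` forces `dimH (g '' I) ≥ t`.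
  set f := Function.invFunOn g I
  have hfg : ∀ y ∈ I, f (g y) = y := fun y hy => hinj.leftInvOn_invFunOn hy
  have hf : HolderOnWith (2 * C).toNNReal t f (g '' I) := by
    rintro _ ⟨y, hy, rfl⟩ _ ⟨y', hy', rfl⟩
    rw [hfg y hy, hfg y' hy', edist_dist, edist_dist, Real.dist_eq, Real.dist_eq,
      ENNReal.ofReal_rpow_of_nonneg (abs_nonneg _) ht'.le]
    change _ ≤ ENNReal.ofReal (2 * C) * _
    rw [← ENNReal.ofReal_mul' (by positivity)]
    exact ENNReal.ofReal_le_ofReal (hol y hy y' hy')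
  have himg : f '' (g '' I) = I := by
    rw [Set.image_image]
    exact (Set.image_congr hfg).trans (Set.image_id' I)
  have hd := hf.dimH_image_le ht
  rw [himg, Real.dimH_of_nonempty_interior (by rw [hI, interior_Ioc]; simp)] at hd
  rw [ENNReal.le_div_iff_mul_le (by simp [ht.ne']) (by simp)] at hd
  simp only [Module.finrank_self, Nat.cast_one, one_mul] at hd
  exact hd.trans (dimH_mono hgE)

end Window

/-! ### Lower bound: the windows adapted to `ψ` -/

/-- An integer larger than `1 / ψ q`. -/
noncomputable def recip (ψ : ℕ → ℝ) (q : ℕ) : ℕ := ⌊1 / ψ q⌋₊ + 1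

lemma one_le_recip (ψ : ℕ → ℝ) (q : ℕ) : 1 ≤ recip ψ q := by unfold recip; omega

lemma lt_recip (ψ : ℕ → ℝ) (q : ℕ) : 1 / ψ q < recip ψ q := by
  unfold recip; push_cast; exact Nat.lt_floor_add_one _

lemma recip_le {ψ : ℕ → ℝ} {q : ℕ} (h : ψ q ∈ Set.Ioc (0 : ℝ) 1) : (recip ψ q : ℝ) ≤ 2 / ψ q := by
  have h1 : (⌊1 / ψ q⌋₊ : ℝ) ≤ 1 / ψ q := Nat.floor_le (by have := h.1; positivity)
  have h2 : 1 ≤ 1 / ψ q := by rw [le_div_iff₀ h.1]; linarith [h.2]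
  have e : 2 / ψ q = 1 / ψ q + 1 / ψ q := by ring
  unfold recip; push_cast; linarith

/-- The product of `d (d - 1)` over the digits `d` of a word. -/
def natVol : List ℕ → ℕ
  | [] => 1
  | d :: w => natVol w * (d * (d - 1))

/-- The denominator of the convergent given by a word, the newest digit first. -/
def wordDenom : List ℕ → ℕ
  | [] => 1
  | d :: w => d * natVol w

lemma natVol_hist (a : ℕ → ℕ) (n : ℕ) :
    natVol (hist a n) = ∏ j ∈ Finset.range n, a j * (a j - 1) := by
  induction n with
  | zero => simp [hist, natVol]
  | succ n ih => rw [hist, natVol, ih, Finset.prod_range_succ]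

lemma wordDenom_hist_digit (x : ℝ) (n : ℕ) : wordDenom (hist (digit x) (n + 1)) = denom x n := by
  rw [hist, wordDenom, natVol_hist]; rfl

section Construction

variable (ψ : ℕ → ℝ) (t : ℝ) (M : ℕ)

/-- The condition on a word `w` of mass `p` under which the next digit is chosen large enough to
give a good approximation. -/
def Jump (w : List ℕ) (p : ℝ) : Prop :=
  Even w.length ∧ p * vol w ^ (t - 1) * (recip ψ (wordDenom w) : ℝ) ^ t ≤ 1

open Classical in
/-- The product of the reciprocals of the gaps of the windows along a word. -/
noncomputable def mass : List ℕ → ℝ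
  | [] => 1
  | _ :: w => mass w *
      if Jump ψ t w (mass w) then 2 * (recip ψ (wordDenom w) : ℝ) else M / ((M : ℝ) - 1)

open Classical in
/-- The lower end of the window of a word. -/
noncomputable def low (w : List ℕ) : ℕ :=
  if Jump ψ t w (mass ψ t M w) then recip ψ (wordDenom w) else 1

open Classical in
/-- The upper end of the window of a word. -/
noncomputable def high (w : List ℕ) : ℕ :=
  if Jump ψ t w (mass ψ t M w) then 2 * recip ψ (wordDenom w) else M

variable {ψ t M}

lemma one_le_low (w : List ℕ) : 1 ≤ low ψ t M w := by
  unfold low; split_ifs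
  · exact one_le_recip _ _
  · exact le_rfl

lemma low_lt_high (hM : 2 ≤ M) (w : List ℕ) : low ψ t M w < high ψ t M w := by
  have := one_le_recip ψ (wordDenom w)
  unfold low high; split_ifs <;> omega

lemma gap_of_jump {w : List ℕ} (h : Jump ψ t w (mass ψ t M w)) :
    gap (low ψ t M) (high ψ t M) w = 1 / (2 * (recip ψ (wordDenom w) : ℝ)) := by
  have : (1 : ℝ) ≤ recip ψ (wordDenom w) := by exact_mod_cast one_le_recip ψ (wordDenom w)
  simp only [gap, low, high, h, if_true]
  push_cast
  field_simp
  norm_num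

lemma gap_of_not_jump (hM : 2 ≤ M) {w : List ℕ} (h : ¬ Jump ψ t w (mass ψ t M w)) :
    gap (low ψ t M) (high ψ t M) w = 1 / (M / ((M : ℝ) - 1)) := by
  have h2 : (2 : ℝ) ≤ M := by exact_mod_cast hM
  have h3 : (M : ℝ) - 1 ≠ 0 := by linarith
  simp only [gap, low, high, h, if_false]
  push_cast
  field_simp

lemma mass_cons (hM : 2 ≤ M) (d : ℕ) (w : List ℕ) :
    mass ψ t M (d :: w) = mass ψ t M w / gap (low ψ t M) (high ψ t M) w := by
  by_cases h : Jump ψ t w (mass ψ t M w)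
  · rw [gap_of_jump h, div_div_eq_mul_div, div_one, mass, if_pos h]
  · rw [gap_of_not_jump hM h, div_div_eq_mul_div, div_one, mass, if_neg h]

lemma mass_pos' (hM : 2 ≤ M) (w : List ℕ) : 0 < mass ψ t M w :=
  mass_pos one_le_low (low_lt_high hM) rfl (mass_cons hM) w

/-- An ordinary step cannot increase the quantity, as `M / (M - 1) ≤ 2^(1-t)` and `d (d - 1) ≥ 2`. A
jump resets it: there `d (d - 1) ≥ N²`, and `2 N * N^(2(t-1)) = 2 N^t * N^(t-1)`, where the jump
condition controls the factor `N^t`. -/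
lemma mass_mul_vol_le (ht : 0 < t) (ht1 : t < 1) (hM : 2 ≤ M)
    (hM' : (M : ℝ) / ((M : ℝ) - 1) ≤ 2 ^ (1 - t)) {w : List ℕ}
    (hw : Admissible (low ψ t M) (high ψ t M) w) : mass ψ t M w * vol w ^ (t - 1) ≤ 2 := by
  induction w with
  | nil => simp [mass, vol]
  | cons d w ih =>
    have hV := hw.1.vol_pos one_le_low
    have hd2 : 2 ≤ d := by have := one_le_low (ψ := ψ) (t := t) (M := M) w; have := hw.2.1; omega
    have hd : (2 : ℝ) ≤ (d : ℝ) * ((d : ℝ) - 1) := two_le_mul_sub_one hd2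
    have hm := mass_pos' (ψ := ψ) (t := t) hM w
    rw [vol, Real.mul_rpow hV.le (by linarith)]
    by_cases h : Jump ψ t w (mass ψ t M w)
    · set N := recip ψ (wordDenom w) with hN
      have hN1 : (1 : ℝ) ≤ N := by exact_mod_cast one_le_recip ψ (wordDenom w)
      have hdN : (N : ℝ) + 1 ≤ d := by
        have := hw.2.1
        simp only [low, h, if_true] at this
        exact_mod_cast this
      have h3 : ((d : ℝ) * ((d : ℝ) - 1)) ^ (t - 1) ≤ ((N : ℝ) * N) ^ (t - 1) :=
        Real.rpow_le_rpow_of_nonpos (by positivity) (by nlinarith) (by linarith)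
      have h4 : mass ψ t M w * vol w ^ (t - 1) * (N : ℝ) ^ t ≤ 1 := h.2
      rw [mass, if_pos h]
      calc mass ψ t M w * (2 * (N : ℝ)) * (vol w ^ (t - 1) * ((d : ℝ) * ((d : ℝ) - 1)) ^ (t - 1))
          ≤ mass ψ t M w * (2 * (N : ℝ)) * (vol w ^ (t - 1) * ((N : ℝ) * N) ^ (t - 1)) := by gcongr
        _ = 2 * (mass ψ t M w * vol w ^ (t - 1) * (N : ℝ) ^ t) * (N : ℝ) ^ (t - 1) := by
          have e : ((N : ℝ) * N) ^ (t - 1) * N = (N : ℝ) ^ t * (N : ℝ) ^ (t - 1) := by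
            rw [Real.mul_rpow (by positivity) (by positivity), mul_right_comm,
              ← Real.rpow_add_one (by positivity), sub_add_cancel]
          calc _ = 2 * (mass ψ t M w * vol w ^ (t - 1)) * (((N : ℝ) * N) ^ (t - 1) * N) := by ring
            _ = _ := by rw [e]; ring
        _ ≤ 2 * 1 * 1 := by
          gcongr
          exact Real.rpow_le_one_of_one_le_of_nonpos hN1 (by linarith)
        _ = 2 := by norm_num
    · rw [mass, if_neg h]
      have h3 : ((d : ℝ) * ((d : ℝ) - 1)) ^ (t - 1) ≤ 2 ^ (t - 1) :=
        Real.rpow_le_rpow_of_nonpos (by positivity) hd (by linarith)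
      calc mass ψ t M w * (M / ((M : ℝ) - 1)) *
            (vol w ^ (t - 1) * ((d : ℝ) * ((d : ℝ) - 1)) ^ (t - 1))
          ≤ mass ψ t M w * 2 ^ (1 - t) * (vol w ^ (t - 1) * 2 ^ (t - 1)) := by gcongr
        _ = mass ψ t M w * vol w ^ (t - 1) * ((2 : ℝ) ^ (1 - t) * 2 ^ (t - 1)) := by ring
        _ = mass ψ t M w * vol w ^ (t - 1) := by
          rw [← Real.rpow_add (by norm_num), show 1 - t + (t - 1) = 0 by ring, Real.rpow_zero,
            mul_one]
        _ ≤ 2 := ih hw.1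

/-- The hypothesis `hC` of `le_dimH_window`. The window at `w` enters through its gap and the one at
`d :: w` through its upper end; at most one of them is a jump, and its jump condition is exactly
what bounds the power of `N` that appears. -/
lemma mass_mul_vol_mul_le (ht : 0 < t) (ht1 : t < 1) (hM : 2 ≤ M)
    (hM' : (M : ℝ) / ((M : ℝ) - 1) ≤ 2 ^ (1 - t)) (d : ℕ) (w : List ℕ)
    (hw : Admissible (low ψ t M) (high ψ t M) (d :: w)) :
    mass ψ t M w * vol w ^ (t - 1) *
      (high ψ t M (d :: w) / gap (low ψ t M) (high ψ t M) w) ^ t ≤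
        2 * (2 * (M : ℝ)) ^ t + (M : ℝ) ^ 2 * 4 ^ t := by
  have hM2 : (2 : ℝ) ≤ M := by exact_mod_cast hM
  have hV := hw.1.vol_pos one_le_low
  have hm := mass_pos' (ψ := ψ) (t := t) hM w
  have hΦ := mass_mul_vol_le ht ht1 hM hM' hw.1
  have hA : 0 ≤ (2 * (M : ℝ)) ^ t := by positivity
  have hB : 0 ≤ (M : ℝ) ^ 2 * 4 ^ t := by positivity
  have hκ2 : (M : ℝ) / ((M : ℝ) - 1) ≤ 2 := by
    rw [div_le_iff₀ (by linarith)]; linarith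
  have hκ1 : 1 ≤ (M : ℝ) / ((M : ℝ) - 1) := by
    rw [le_div_iff₀ (by linarith)]; linarith
  by_cases h : Jump ψ t w (mass ψ t M w)
  · have h' : ¬ Jump ψ t (d :: w) (mass ψ t M (d :: w)) := by
      intro h'
      have h1 := h'.1
      rw [List.length_cons, Nat.even_add_one] at h1
      exact h1 h.1
    have h4 := h.2
    set N := recip ψ (wordDenom w) with hN
    rw [gap_of_jump h, high, if_neg h', div_div_eq_mul_div, div_one,
      show (M : ℝ) * (2 * (N : ℝ)) = N * (2 * M) by ring,
      Real.mul_rpow (by positivity) (by positivity), ← mul_assoc]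
    have : mass ψ t M w * vol w ^ (t - 1) * (N : ℝ) ^ t * (2 * (M : ℝ)) ^ t ≤
        1 * (2 * (M : ℝ)) ^ t := mul_le_mul_of_nonneg_right h4 hA
    linarith
  · rw [gap_of_not_jump hM h, div_div_eq_mul_div, div_one]
    by_cases h' : Jump ψ t (d :: w) (mass ψ t M (d :: w))
    · have h4 := h'.2
      rw [high, if_pos h']
      set N := recip ψ (wordDenom (d :: w)) with hN
      have hd2 : 2 ≤ d := by
        have := one_le_low (ψ := ψ) (t := t) (M := M) w; have := hw.2.1; omega
      have hd : (2 : ℝ) ≤ (d : ℝ) * ((d : ℝ) - 1) := two_le_mul_sub_one hd2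
      have hdM : (d : ℝ) ≤ M := by
        have := hw.2.2
        simp only [high, h, if_false] at this
        exact_mod_cast this
      -- The jump condition holds at `d :: w` but is needed at `w`; as `d ≤ M`, the transfer costs
      -- at most `M²`.
      have hdd : ((M : ℝ) ^ 2)⁻¹ ≤ ((d : ℝ) * ((d : ℝ) - 1)) ^ (t - 1) := by
        calc ((M : ℝ) ^ 2)⁻¹ ≤ ((d : ℝ) * ((d : ℝ) - 1))⁻¹ := by
              refine inv_anti₀ (by linarith) ?_
              have : (0 : ℝ) ≤ d := by positivity
              nlinarith
          _ = ((d : ℝ) * ((d : ℝ) - 1)) ^ (-1 : ℝ) := (Real.rpow_neg_one _).symm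
          _ ≤ _ := Real.rpow_le_rpow_of_exponent_le (by linarith) (by linarith)
      rw [mass, if_neg h, vol, Real.mul_rpow hV.le (by linarith)] at h4
      have h5 : mass ψ t M w * vol w ^ (t - 1) * (N : ℝ) ^ t ≤ (M : ℝ) ^ 2 := by
        have h6 : mass ψ t M w * 1 * (vol w ^ (t - 1) * ((M : ℝ) ^ 2)⁻¹) * (N : ℝ) ^ t ≤ 1 := by
          refine le_trans ?_ h4
          gcongr
        calc mass ψ t M w * vol w ^ (t - 1) * (N : ℝ) ^ t = (M : ℝ) ^ 2 *
              (mass ψ t M w * 1 * (vol w ^ (t - 1) * ((M : ℝ) ^ 2)⁻¹) * (N : ℝ) ^ t) := by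
              field_simp
          _ ≤ (M : ℝ) ^ 2 * 1 := by gcongr
          _ = _ := mul_one _
      push_cast
      calc mass ψ t M w * vol w ^ (t - 1) * (2 * (N : ℝ) * (M / ((M : ℝ) - 1))) ^ t
          ≤ mass ψ t M w * vol w ^ (t - 1) * (N * 4 : ℝ) ^ t := by
            have : 2 * (N : ℝ) * (M / ((M : ℝ) - 1)) ≤ N * 4 := by
              have : (N : ℝ) * (M / ((M : ℝ) - 1)) ≤ N * 2 := by gcongr
              linarith
            have h0 : 0 ≤ 2 * (N : ℝ) * (M / ((M : ℝ) - 1)) :=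
              mul_nonneg (by positivity) (by linarith)
            gcongr
        _ = mass ψ t M w * vol w ^ (t - 1) * (N : ℝ) ^ t * 4 ^ t := by
            rw [Real.mul_rpow (by positivity) (by positivity)]; ring
        _ ≤ (M : ℝ) ^ 2 * 4 ^ t := by gcongr
        _ ≤ _ := by linarith
    · rw [high, if_neg h']
      calc mass ψ t M w * vol w ^ (t - 1) * (M * (M / ((M : ℝ) - 1))) ^ t
          ≤ 2 * (2 * (M : ℝ)) ^ t := by
            have : (M : ℝ) * (M / ((M : ℝ) - 1)) ≤ 2 * M := by
              rw [mul_comm 2]; gcongr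
            have h0 : 0 ≤ (M : ℝ) * (M / ((M : ℝ) - 1)) :=
              mul_nonneg (by positivity) (by linarith)
            gcongr
        _ ≤ _ := by linarith

/-- After a jump the next digit exceeds `N > 1/ψ(Q)`, hence `T^(n+1) x ≤ 1/(d - 1) ≤ 1/N < ψ(Q)` in
the 0-based indexing of `denom`. -/
lemma mem_wellApproximable_of_jump {x : ℝ} (hψ : ∀ q : ℕ, 1 ≤ q → ψ q ∈ Set.Ioc (0 : ℝ) 1)
    (hx : x ∈ Set.Ioc (0 : ℝ) 1) (hlow : ∀ m, low ψ t M (hist (digit x) m) < digit x m)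
    (hj : ∃ᶠ m in atTop, Jump ψ t (hist (digit x) m) (mass ψ t M (hist (digit x) m))) :
    x ∈ wellApproximable ψ := by
  rw [wellApproximable, mem_limsup_iff_frequently_mem]
  rw [frequently_atTop] at hj ⊢
  intro n₀
  obtain ⟨m, hm, hjm⟩ := hj (n₀ + 1)
  obtain ⟨n, rfl⟩ : ∃ n, m = n + 1 := ⟨m - 1, by omega⟩
  refine ⟨n, by omega, hx, ?_⟩
  rw [num_div_denom hx, sub_convergent hx]
  have hu := iterate_map_mem hx (n + 1)
  have hV := volProd_pos (two_le_digit hx) (n + 1)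
  have hQ := denom_pos hx n
  have hψq := hψ (denom x n) (by exact_mod_cast hQ)
  rw [abs_of_pos (div_pos hu.1 hV)]
  have hd : (2 : ℝ) ≤ digit x n := by exact_mod_cast two_le_digit hx n
  -- The two sides differ by the factor `d - 1 ≥ 1` of the last digit.
  have hQV : (denom x n : ℝ) ≤ volProd (digit x) (n + 1) := by
    rw [cast_denom hx, volProd_succ]
    have := volProd_pos (two_le_digit hx) n
    have h1 : 0 < digit x n * volProd (digit x) n := by positivity
    nlinarith
  have hN := hlow (n + 1)
  simp only [low, hjm, if_true] at hN
  rw [wordDenom_hist_digit] at hN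
  have hN' : (recip ψ (denom x n) : ℝ) ≤ digit x (n + 1) - 1 := by
    have : (recip ψ (denom x n) : ℝ) + 1 ≤ digit x (n + 1) := by exact_mod_cast hN
    linarith
  have h1 := lt_recip ψ (denom x n)
  have h2 : map^[n + 1] x < ψ (denom x n) := by
    have h3 := le_head hu
    rw [← digit_eq_head] at h3
    refine h3.trans_lt ?_
    have := hψq.1
    rw [div_lt_iff₀ hψq.1] at h1
    have h4 : (2 : ℝ) ≤ digit x (n + 1) := by exact_mod_cast two_le_digit hx (n + 1)
    rw [div_lt_iff₀ (by linarith)]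
    nlinarith
  calc map^[n + 1] x / volProd (digit x) (n + 1) ≤ map^[n + 1] x / denom x n := by
        have := hu.1
        gcongr
    _ < _ := div_lt_div_of_pos_right h2 hQ

end Construction

/-! ### Lower bound: jumps recur -/

/-- Transfers a lower bound for `ψ` from `q` to a comparable `Q`. Since `1 - s = s τ`, the bound at
`q` says `θ_s(q) ≥ q^(-sε)`, which passes to `Q` through `hθ`; raising to the power `t/s` yields
`ψ(Q)^t`. -/
lemma le_rpow_of_theta_le {ψ : ℕ → ℝ} {s τ ε t K : ℝ} (hs : 0 < s) (hsτ : s * (1 + τ) = 1)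
    (hε : 0 < ε) (ht : 0 < t) (hK : 0 < K) {Q q : ℕ} (hQ : 1 ≤ Q) (hq : 1 ≤ q)
    (hψQ : 0 < ψ Q) (hqQ : (q : ℝ) ≤ K * Q)
    (hθ : theta s ψ q ≤ theta s ψ Q) (hψq : (q : ℝ) ^ (-(τ + ε)) ≤ ψ q) :
    K ^ (-(t * ε)) * (Q : ℝ) ^ (-(t * (τ + ε))) ≤ ψ Q ^ t := by
  have hQ0 : (0 : ℝ) < Q := by exact_mod_cast hQ
  have hq0 : (0 : ℝ) < q := by exact_mod_cast hq
  have h1 : (K * Q) ^ (-(s * ε)) ≤ (Q : ℝ) ^ (1 - s) * ψ Q ^ s := by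
    calc (K * Q) ^ (-(s * ε)) ≤ (q : ℝ) ^ (-(s * ε)) :=
          Real.rpow_le_rpow_of_nonpos hq0 hqQ (by have := mul_pos hs hε; linarith)
      _ = (q : ℝ) ^ (1 - s) * ((q : ℝ) ^ (-(τ + ε))) ^ s := by
          rw [← Real.rpow_mul hq0.le, ← Real.rpow_add hq0]
          congr 1
          linear_combination hsτ
      _ ≤ (q : ℝ) ^ (1 - s) * ψ q ^ s := by gcongr
      _ ≤ _ := hθ
  have h2 := Real.rpow_le_rpow (by positivity) h1 (show 0 ≤ t / s by positivity)
  rw [← Real.rpow_mul (show 0 ≤ K * (Q : ℝ) by positivity),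
    Real.mul_rpow (x := (Q : ℝ) ^ (1 - s)) (by positivity) (by positivity),
    ← Real.rpow_mul hQ0.le, ← Real.rpow_mul hψQ.le, mul_div_cancel₀ _ hs.ne',
    Real.mul_rpow hK.le hQ0.le] at h2
  have e1 : -(s * ε) * (t / s) = -(t * ε) := by field_simp
  have e2 : (1 - s) * (t / s) = t * τ := by
    field_simp
    linear_combination -hsτ
  rw [e1, e2] at h2
  calc K ^ (-(t * ε)) * (Q : ℝ) ^ (-(t * (τ + ε)))
      = (Q : ℝ) ^ (-(t * τ)) * (K ^ (-(t * ε)) * (Q : ℝ) ^ (-(t * ε))) := by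
        rw [show -(t * (τ + ε)) = -(t * τ) + -(t * ε) by ring, Real.rpow_add hQ0]; ring
    _ ≤ (Q : ℝ) ^ (-(t * τ)) * ((Q : ℝ) ^ (t * τ) * ψ Q ^ t) := by gcongr
    _ = ψ Q ^ t := by
        rw [← mul_assoc, ← Real.rpow_add hQ0]; simp

/-- A sequence of natural numbers that grows at most geometrically meets every scale. -/
lemma exists_le_lt_of_unbounded {f : ℕ → ℕ} (hf : ∀ b, ∃ j, b < f j) {q : ℕ} (h0 : f 0 ≤ q) :
    ∃ j, f j ≤ q ∧ q < f (j + 1) := by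
  classical
  have h := Nat.find_spec (hf q)
  have hne : Nat.find (hf q) ≠ 0 := by
    intro e
    rw [e] at h
    omega
  obtain ⟨j, hj⟩ := Nat.exists_eq_succ_of_ne_zero hne
  refine ⟨j, ?_, by rw [hj] at h; exact h⟩
  have := Nat.find_min (hf q) (show j < _ by omega)
  omega

/-- If jumps stop, the digits are at most `M` and the mass grows no faster than `vol^η`. Failure of
the jump condition then forces `ψ(Q)^t` to be at most a constant times `Q^(η+t-1)` at every
even-length denominator, whereas the transfer from a good `q` gives at least a constant times
`Q^(-t(τ+ε))`. By `hsmall` these are incompatible for large `Q`. -/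
lemma frequently_jump {ψ : ℕ → ℝ} {s τ ε t η : ℝ} {M : ℕ}
    (hψ : ∀ q : ℕ, 1 ≤ q → ψ q ∈ Set.Ioc (0 : ℝ) 1) (hs : 0 < s) (hsτ : s * (1 + τ) = 1)
    (hε : 0 < ε) (ht : 0 < t) (hη : 0 < η) (hsmall : η + t + t * (τ + ε) < 1) (hτ : 0 < τ)
    (hM : 2 ≤ M) (hM' : (M : ℝ) / ((M : ℝ) - 1) ≤ 2 ^ η)
    (hθ : AntitoneOn (theta s ψ) (Set.Ici 1))
    (hfreq : ∃ᶠ q : ℕ in atTop, (q : ℝ) ^ (-(τ + ε)) ≤ ψ q) {x : ℝ}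
    (hx : x ∈ Set.Ioc (0 : ℝ) 1)
    (hhigh : ∀ m, digit x m ≤ high ψ t M (hist (digit x) m)) :
    ∃ᶠ m in atTop, Jump ψ t (hist (digit x) m) (mass ψ t M (hist (digit x) m)) := by
  rw [frequently_atTop]
  by_contra! hcon
  obtain ⟨m₀, hm₀⟩ := hcon
  set a := digit x with ha
  have ha2 : ∀ n, 2 ≤ a n := two_le_digit hx
  have hM2 : (2 : ℝ) ≤ M := by exact_mod_cast hM
  have haM : ∀ m, m₀ ≤ m → a m ≤ M := by
    intro m hm
    have := hhigh m
    rwa [high, if_neg (hm₀ m hm)] at this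
  set p := mass ψ t M (hist a m₀) with hp
  have hp0 : 0 < p := mass_pos' hM _
  have hκ0 : 0 ≤ (M : ℝ) / ((M : ℝ) - 1) := div_nonneg (by linarith) (by linarith)
  have hmass : ∀ k, mass ψ t M (hist a (m₀ + k)) = p * (M / ((M : ℝ) - 1)) ^ k := by
    intro k
    induction k with
    | zero => simp [hp]
    | succ k ih =>
      rw [← add_assoc, hist, mass, if_neg (hm₀ _ (by omega)), ih, pow_succ]; ring
  have hmassV : ∀ m, m₀ ≤ m → mass ψ t M (hist a m) ≤ p * vol (hist a m) ^ η := by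
    intro m hm
    obtain ⟨k, rfl⟩ := Nat.exists_eq_add_of_le hm
    rw [hmass]
    have hV : (2 : ℝ) ^ (m₀ + k) ≤ vol (hist a (m₀ + k)) := by
      rw [vol_hist]; exact two_pow_le_volProd ha2 _
    have : (M / ((M : ℝ) - 1)) ^ k ≤ vol (hist a (m₀ + k)) ^ η := by
      calc (M / ((M : ℝ) - 1)) ^ k ≤ ((2 : ℝ) ^ η) ^ k := by gcongr
        _ = ((2 : ℝ) ^ k) ^ η := by
          rw [← Real.rpow_natCast, ← Real.rpow_natCast, ← Real.rpow_mul (by norm_num),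
            ← Real.rpow_mul (by norm_num), mul_comm]
        _ ≤ _ := by
          refine Real.rpow_le_rpow (by positivity) (le_trans ?_ hV) hη.le
          exact pow_le_pow_right₀ (by norm_num) (by omega)
    gcongr
  -- Only even lengths are kept, since at odd lengths failure to jump carries no information.
  set f : ℕ → ℕ := fun j => wordDenom (hist a (2 * (m₀ + 1) + 2 * j)) with hf
  have hfd : ∀ j, f j = denom x (2 * m₀ + 1 + 2 * j) := by
    intro j
    rw [← wordDenom_hist_digit, hf]
    simp only
    congr 2; ring
  have hf1 : ∀ j, 1 ≤ f j := by
    intro j; rw [hfd]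
    exact_mod_cast denom_pos hx _
  have hfunb : ∀ b, ∃ j, b < f j := by
    intro b
    refine ⟨b, ?_⟩
    rw [hfd]
    have h1 := two_pow_le_denom hx (2 * m₀ + 1 + 2 * b)
    have h2 : 2 ^ (2 * m₀ + 1 + 2 * b + 1) ≤ denom x (2 * m₀ + 1 + 2 * b) := by exact_mod_cast h1
    have h3 : 2 * m₀ + 1 + 2 * b + 1 < 2 ^ (2 * m₀ + 1 + 2 * b + 1) := Nat.lt_two_pow_self
    omega
  -- Two more digits add four factors, each at most `M`.
  have hfstep : ∀ j, f (j + 1) ≤ M ^ 4 * f j := by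
    intro j
    set n := 2 * m₀ + 1 + 2 * j with hn
    rw [hfd, hfd, ← hn, show 2 * m₀ + 1 + 2 * (j + 1) = n + 2 by omega]
    have h0 := haM n (by omega)
    have h1 := haM (n + 1) (by omega)
    have h2 := haM (n + 2) (by omega)
    unfold denom
    rw [← ha, Finset.prod_range_succ, Finset.prod_range_succ]
    set R := ∏ j ∈ Finset.range n, a j * (a j - 1)
    calc a (n + 2) * (R * (a n * (a n - 1)) * (a (n + 1) * (a (n + 1) - 1)))
        ≤ M * (R * (a n * M) * (M * M)) := by gcongr <;> omega
      _ = M ^ 4 * (a n * R) := by ring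
  have hnj : ∀ j, ψ (f j) ^ t ≤ p * 2 ^ t * (f j : ℝ) ^ (η + t - 1) := by
    intro j
    set m := 2 * (m₀ + 1) + 2 * j with hm
    have hj := hm₀ m (by omega)
    have hev : Even (hist a m).length := by
      rw [length_hist, hm]; exact ⟨m₀ + 1 + j, by ring⟩
    have h1 : 1 < mass ψ t M (hist a m) * vol (hist a m) ^ (t - 1) *
        (recip ψ (wordDenom (hist a m)) : ℝ) ^ t := by
      by_contra h
      exact hj ⟨hev, not_lt.1 h⟩
    have hψf := hψ (f j) (hf1 j)
    have hV0 : 0 < vol (hist a m) := by rw [vol_hist]; exact volProd_pos ha2 m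
    have hf0 : (0 : ℝ) < f j := by exact_mod_cast hf1 j
    have hfV : (f j : ℝ) ≤ vol (hist a m) := by
      rw [hfd, vol_hist, cast_denom hx, hm,
        show 2 * (m₀ + 1) + 2 * j = 2 * m₀ + 1 + 2 * j + 1 by ring,
        volProd_succ, ← ha]
      have h3 := volProd_pos ha2 (2 * m₀ + 1 + 2 * j)
      have h4 : (2 : ℝ) ≤ a (2 * m₀ + 1 + 2 * j) := by exact_mod_cast ha2 _
      have h5 : 0 < (a (2 * m₀ + 1 + 2 * j) : ℝ) * volProd a (2 * m₀ + 1 + 2 * j) := by positivity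
      nlinarith
    have hψt : 0 < ψ (f j) ^ t := Real.rpow_pos_of_pos hψf.1 t
    have h2 : 1 ≤ p * (f j : ℝ) ^ (η + t - 1) * (2 ^ t / ψ (f j) ^ t) := by
      calc 1 ≤ mass ψ t M (hist a m) * vol (hist a m) ^ (t - 1) *
            (recip ψ (f j) : ℝ) ^ t := h1.le
        _ ≤ p * vol (hist a m) ^ η * vol (hist a m) ^ (t - 1) * (2 / ψ (f j)) ^ t := by
            have := hmassV m (by omega)
            have := recip_le hψf
            gcongr
        _ = p * vol (hist a m) ^ (η + t - 1) * (2 ^ t / ψ (f j) ^ t) := by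
            rw [Real.div_rpow (by norm_num) hψf.1.le, mul_assoc p, ← Real.rpow_add hV0,
              add_sub_assoc]
        _ ≤ _ := by
            have : vol (hist a m) ^ (η + t - 1) ≤ (f j : ℝ) ^ (η + t - 1) :=
              Real.rpow_le_rpow_of_nonpos hf0 hfV (by nlinarith [mul_pos ht hτ, mul_pos ht hε])
            gcongr
    calc ψ (f j) ^ t = 1 * ψ (f j) ^ t := (one_mul _).symm
      _ ≤ p * (f j : ℝ) ^ (η + t - 1) * (2 ^ t / ψ (f j) ^ t) * ψ (f j) ^ t := by gcongr
      _ = _ := by field_simp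
  -- The slack in `hsmall`: the two bounds combine to `(f j)^γ ≤ D`, which is refuted by taking `q`,
  -- and with it `f j ≥ q / K`, large.
  set γ := 1 - (η + t + t * (τ + ε)) with hγ
  have hγ0 : 0 < γ := by linarith
  set K : ℝ := (M : ℝ) ^ 4 with hK
  have hK0 : 0 < K := by positivity
  set D := p * 2 ^ t * K ^ (t * ε) with hD
  have hev : ∀ᶠ q : ℕ in atTop, D < ((q : ℝ) / K) ^ γ := by
    have : Tendsto (fun q : ℕ => ((q : ℝ) / K) ^ γ) atTop atTop :=
      (tendsto_rpow_atTop hγ0).comp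
        (tendsto_natCast_atTop_atTop.atTop_div_const hK0)
    exact this.eventually_gt_atTop D
  obtain ⟨q, hq, hDq, hqf⟩ := (hfreq.and_eventually
    (hev.and (eventually_ge_atTop (f 0)))).exists
  obtain ⟨j, hj, hj'⟩ := exists_le_lt_of_unbounded hfunb hqf
  have hqK : (q : ℝ) ≤ K * f j := by
    have h1 : q ≤ M ^ 4 * f j := hj'.le.trans (hfstep j)
    have h2 : (q : ℝ) ≤ ((M ^ 4 * f j : ℕ) : ℝ) := by exact_mod_cast h1
    rw [hK]; push_cast at h2; exact h2
  have hq1 : 1 ≤ q := (hf1 j).trans hj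
  have hf0 : (0 : ℝ) < f j := by exact_mod_cast hf1 j
  have h1 := le_rpow_of_theta_le hs hsτ hε ht hK0 (hf1 j) hq1 (hψ _ (hf1 j)).1 hqK
    (hθ (Set.mem_Ici.2 (hf1 j)) (Set.mem_Ici.2 hq1) hj) hq
  have h2 := h1.trans (hnj j)
  have h3 : (f j : ℝ) ^ γ ≤ D := by
    calc (f j : ℝ) ^ γ = K ^ (t * ε) * (f j : ℝ) ^ (1 - η - t) *
          (K ^ (-(t * ε)) * (f j : ℝ) ^ (-(t * (τ + ε)))) := by
          rw [mul_mul_mul_comm, ← Real.rpow_add hK0, ← Real.rpow_add hf0, add_neg_cancel,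
            Real.rpow_zero, one_mul, hγ]
          congr 1; ring
      _ ≤ K ^ (t * ε) * (f j : ℝ) ^ (1 - η - t) * (p * 2 ^ t * (f j : ℝ) ^ (η + t - 1)) := by
          gcongr
      _ = D * ((f j : ℝ) ^ (1 - η - t) * (f j : ℝ) ^ (η + t - 1)) := by rw [hD]; ring
      _ = D := by
          rw [← Real.rpow_add hf0, show 1 - η - t + (η + t - 1) = 0 by ring, Real.rpow_zero,
            mul_one]
  have h4 : ((q : ℝ) / K) ^ γ ≤ (f j : ℝ) ^ γ := by
    refine Real.rpow_le_rpow (by positivity) ?_ hγ0.le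
    rw [div_le_iff₀ hK0]; linarith
  linarith

/-! ### Choice of parameters and the two bounds -/

lemma exists_base {η : ℝ} (hη : 0 < η) :
    ∃ M : ℕ, 2 ≤ M ∧ (M : ℝ) / ((M : ℝ) - 1) ≤ 2 ^ η := by
  have h1 : Tendsto (fun n : ℕ => 1 + 1 / ((n : ℝ) + 1)) atTop (𝓝 (1 + 0)) :=
    tendsto_one_div_add_atTop_nhds_zero_nat.const_add 1
  rw [add_zero] at h1
  obtain ⟨n, hn⟩ := (h1.eventually_lt_const
    (Real.one_lt_rpow (by norm_num : (1 : ℝ) < 2) hη)).exists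
  refine ⟨n + 2, by omega, le_trans (le_of_eq ?_) hn.le⟩
  push_cast
  rw [show (n : ℝ) + 2 - 1 = n + 1 by ring]
  field_simp
  ring

lemma le_dimH_wellApproximable {ψ : ℕ → ℝ} {s τ : ℝ}
    (hψ : ∀ q : ℕ, 1 ≤ q → ψ q ∈ Set.Ioc (0 : ℝ) 1) (hs : 0 < s) (hsτ : s * (1 + τ) = 1)
    (hτ : 0 < τ) (hθ : AntitoneOn (theta s ψ) (Set.Ici 1))
    (hfreq : ∀ ε > 0, ∃ᶠ q : ℕ in atTop, (q : ℝ) ^ (-(τ + ε)) ≤ ψ q) :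
    ENNReal.ofReal s ≤ dimH (wellApproximable ψ) := by
  refine le_of_forall_lt_imp_le_of_dense fun b hb => ?_
  lift b to NNReal using hb.ne_top
  rcases eq_or_ne b 0 with rfl | hb0
  · simp
  have hb1 : (b : ℝ) < s := by
    rw [ENNReal.ofReal, ENNReal.coe_lt_coe] at hb
    exact (Real.lt_toNNReal_iff_coe_lt).1 hb
  have hbpos : 0 < b := pos_iff_ne_zero.2 hb0
  have ht : (0 : ℝ) < b := by exact_mod_cast hbpos
  set t : ℝ := (b : ℝ) with htdef
  -- The deficit `1 - t (1 + τ)` is positive because `t < s`. One third pays for the mass growth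
  -- `η`, one for `t ε`, and one keeps `hsmall` strict.
  set δ := (1 - t * (1 + τ)) / 3 with hδ
  have hδ0 : 0 < δ := by
    have : t * (1 + τ) < s * (1 + τ) := by gcongr
    rw [hδ]; linarith
  have htτ : t * (1 + τ) = 1 - 3 * δ := by rw [hδ]; ring
  have hmul : 0 < t * τ := mul_pos ht hτ
  have hε : 0 < δ / t := by positivity
  have htε : t * (δ / t) = δ := by field_simp
  have hsmall : δ + t + t * (τ + δ / t) < 1 := by rw [mul_add, htε]; linarith
  have ht1 : t < 1 := by nlinarith
  obtain ⟨M, hM, hM'⟩ := exists_base hδ0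
  have hM1 : (M : ℝ) / ((M : ℝ) - 1) ≤ 2 ^ (1 - t) :=
    hM'.trans (Real.rpow_le_rpow_of_exponent_le (by norm_num) (by linarith))
  refine (le_dimH_window (lo := low ψ t M) (hi := high ψ t M) (P := mass ψ t M) one_le_low
    (low_lt_high hM) rfl (mass_cons hM) hbpos (by exact_mod_cast ht1.le)
    (mass_mul_vol_mul_le ht ht1 hM hM1)).trans (dimH_mono ?_)
  rintro x ⟨hx, hw⟩
  exact mem_wellApproximable_of_jump hψ hx (fun m => (hw m).1)
    (frequently_jump hψ hs hsτ hε ht hδ0 hsmall hτ hM hM' hθ (hfreq _ hε) hx fun m => (hw m).2)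

lemma eventually_le_rpow {ψ : ℕ → ℝ} (hψ : ∀ q : ℕ, 1 ≤ q → ψ q ∈ Set.Ioc (0 : ℝ) 1) {c : ℝ}
    (h : (c : EReal) < lowerOrder ψ) :
    ∀ᶠ q : ℕ in atTop, ψ q / q ≤ (q : ℝ) ^ (-(1 + c)) := by
  have := eventually_lt_of_lt_liminf h
  filter_upwards [this, eventually_ge_atTop 2] with q hq hq2
  have hq' : c < -Real.log (ψ q) / Real.log q := by exact_mod_cast hq
  have h2 : (2 : ℝ) ≤ q := by exact_mod_cast hq2
  have hlog : 0 < Real.log q := Real.log_pos (by linarith)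
  have hψq := (hψ q (by omega)).1
  rw [lt_div_iff₀ hlog] at hq'
  have h3 : ψ q ≤ (q : ℝ) ^ (-c) := by
    rw [← Real.log_le_log_iff hψq (by positivity), Real.log_rpow (by linarith)]
    linarith
  rw [show -(1 + c) = -c - 1 by ring, Real.rpow_sub_one (by linarith)]
  gcongr

lemma frequently_rpow_le {ψ : ℕ → ℝ} (hψ : ∀ q : ℕ, 1 ≤ q → ψ q ∈ Set.Ioc (0 : ℝ) 1) {c : ℝ}
    (h : lowerOrder ψ < (c : EReal)) : ∃ᶠ q : ℕ in atTop, (q : ℝ) ^ (-c) ≤ ψ q := by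
  have := frequently_lt_of_liminf_lt (by isBoundedDefault) h
  refine (this.and_eventually (eventually_ge_atTop 2)).mono fun q ⟨hq, hq2⟩ => ?_
  have hq' : -Real.log (ψ q) / Real.log q < c := by exact_mod_cast hq
  have h2 : (2 : ℝ) ≤ q := by exact_mod_cast hq2
  have hlog : 0 < Real.log q := Real.log_pos (by linarith)
  have hψq := (hψ q (by omega)).1
  rw [div_lt_iff₀ hlog] at hq'
  rw [← Real.log_le_log_iff (by positivity) hψq, Real.log_rpow (by linarith)]
  linarith

lemma dimH_wellApproximable_le_inv {ψ : ℕ → ℝ} (hψ : ∀ q : ℕ, 1 ≤ q → ψ q ∈ Set.Ioc (0 : ℝ) 1)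
    {c : ℝ} (hc : 0 ≤ c) (h : (c : EReal) < lowerOrder ψ) :
    dimH (wellApproximable ψ) ≤ ENNReal.ofReal (1 / (1 + c)) := by
  refine le_of_forall_gt_imp_ge_of_dense fun b hb => ?_
  rcases eq_or_ne b ∞ with rfl | hbt
  · exact le_top
  lift b to NNReal using hbt
  refine dimH_wellApproximable_le b (c := 1 + c) (by linarith) (eventually_le_rpow hψ h) ?_
  have h1 : 1 / (1 + c) < b := by
    rw [ENNReal.ofReal, ENNReal.coe_lt_coe] at hb
    exact (Real.toNNReal_lt_iff_lt_coe (by positivity)).1 hb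
  rw [div_lt_iff₀ (by linarith)] at h1
  linarith

end Luroth

theorem theorem6 (ψ : ℕ → ℝ)
    (hψ : ∀ q : ℕ, 1 ≤ q → ψ q ∈ Set.Ioc (0 : ℝ) 1)
    (hτ : 1 < Luroth.lowerOrder ψ)
    (hθ : AntitoneOn (Luroth.theta (Luroth.exponent ψ) ψ) (Set.Ici 1))
    (hdiv : Tendsto (fun N : ℕ => ∑ q ∈ Finset.Icc 1 N,
      (ψ q / (q : ℝ)) ^ Luroth.exponent ψ * Real.log q) atTop atTop) :
    ((dimH (Luroth.wellApproximable ψ) : ENNReal) : EReal) =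
      1 / (1 + Luroth.lowerOrder ψ) := by
  have hinv : Tendsto (fun c : ℝ => ENNReal.ofReal (1 / (1 + c))) atTop (nhds 0) := by
    have : Tendsto (fun c : ℝ => 1 / (1 + c)) atTop (nhds 0) :=
      (tendsto_const_nhds (x := (1 : ℝ))).div_atTop (tendsto_atTop_add_const_left _ 1 tendsto_id)
    simpa using ENNReal.tendsto_ofReal this
  induction hL : Luroth.lowerOrder ψ with
  | bot => rw [hL] at hτ; simp at hτ
  | top =>
    -- For infinite lower order the upper bound alone suffices: let `c → ∞`.
    have h0 : dimH (Luroth.wellApproximable ψ) ≤ 0 := by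
      refine ge_of_tendsto hinv ?_
      filter_upwards [eventually_ge_atTop 0] with c hc
      exact Luroth.dimH_wellApproximable_le_inv hψ hc (by rw [hL]; exact EReal.coe_lt_top c)
    rw [le_antisymm h0 bot_le]
    rw [EReal.add_top_of_ne_bot (by decide)]
    simp
  | coe τ =>
    rw [hL] at hτ
    have hτ1 : 1 < τ := by exact_mod_cast hτ
    have hexp : (1 : EReal) / (1 + (τ : EReal)) = ((1 / (1 + τ) : ℝ) : EReal) := by
      rw [EReal.coe_div]; norm_cast
    have hs : Luroth.exponent ψ = 1 / (1 + τ) := by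
      rw [Luroth.exponent, hL, hexp, EReal.toReal_coe]
    rw [hs] at hθ
    have hs0 : 0 < 1 / (1 + τ) := by positivity
    -- The cover bound needs `c` strictly below the lower order, so `c` increases to `τ`.
    have hup : dimH (Luroth.wellApproximable ψ) ≤ ENNReal.ofReal (1 / (1 + τ)) := by
      have hcont : Tendsto (fun c : ℝ => ENNReal.ofReal (1 / (1 + c))) (nhdsWithin τ (Set.Iio τ))
          (nhds (ENNReal.ofReal (1 / (1 + τ)))) := by
        refine ENNReal.tendsto_ofReal (tendsto_nhdsWithin_of_tendsto_nhds ?_)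
        exact (ContinuousAt.div (by fun_prop) (by fun_prop) (by linarith))
      refine ge_of_tendsto hcont ?_
      filter_upwards [Ioo_mem_nhdsLT (show (0 : ℝ) < τ by linarith)] with c hc
      exact Luroth.dimH_wellApproximable_le_inv hψ hc.1.le
        (by rw [hL]; exact EReal.coe_lt_coe_iff.2 hc.2)
    have hlow := Luroth.le_dimH_wellApproximable hψ hs0 (by field_simp) (by linarith) hθ
      fun ε hε => Luroth.frequently_rpow_le hψ
        (by rw [hL]; exact EReal.coe_lt_coe_iff.2 (by linarith))
    rw [le_antisymm hup hlow, hexp, EReal.coe_ennreal_ofReal, max_eq_left hs0.le]
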